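/- Let $d\ge 1$ and let $\mu,\nu$ be finite, mutually singular Borel measures on $\mathbb R^d$ with $\mu(\mathbb R^d)\ge\nu(\mathbb R^d)$. Assume that $\mu$ does not charge small sets, i.e. $\mu(S)=0$ for every $(d-1)$-rectifiable set $S$, where $S$ is called $(d-1)$-rectifiable if it is covered by the images of countably many Lipschitz maps $\mathbb R^{d-1}\to\mathbb R^d$. Let $\vartheta:[0,\infty)\to[0,\infty)$ be concave and strictly increasing. A semicoupling of $\mu$ and $\nu$ is a Borel measure $q$ on $\mathbb R^d\times\mathbb R^d$ whose first marginal is $\le\mu$ and whose second marginal equals $\nu$; the set of these is denoted $\mathsf{Cpl}_s(\mu,\nu)$. Consider the problem $$\inf_{q\in\mathsf{Cpl}_s(\mu,\nu)}\int\vartheta(|x-y|)\,dq(x,y),\qquad(*)$$ and assume that this infimum is finite (which is automatic if $\mu$ and $\nu$ have compact supports). Then $(*)$ has an optimizer, and there is a Borel set $B\subseteq\mathbb R^d$ such that every optimizer of $(*)$ has first marginal $1_B\mu$. If moreover $\vartheta$ is strictly concave, then $(*)$ has a unique optimizer $q^*$, and $q^*=(\mathrm{id},T)_\#(1_B\mu)$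 for some Borel map $T:\mathbb R^d\to\mathbb R^d$. -/

import Mathlib

open MeasureTheory Set
open scoped ENNReal NNReal

/-- `S ⊆ ℝ^d` is (countably) `m`-rectifiable: it is covered by the images of countably many
Lipschitz maps `ℝ^m → ℝ^d`. For `m = 0` these are the countable sets. -/
def IsRectifiableSet {d : ℕ} (m : ℕ) (S : Set (EuclideanSpace ℝ (Fin d))) : Prop :=
  ∃ f : ℕ → EuclideanSpace ℝ (Fin m) → EuclideanSpace ℝ (Fin d),
    (∀ n, ∃ K : ℝ≥0, LipschitzWith K (f n)) ∧ S ⊆ ⋃ n, range (f n)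

/-- `μ` does not charge small sets: every `(d-1)`-rectifiable set is `μ`-null. -/
def DoesNotChargeSmallSets {d : ℕ} (μ : Measure (EuclideanSpace ℝ (Fin d))) : Prop :=
  ∀ S : Set (EuclideanSpace ℝ (Fin d)), IsRectifiableSet (d - 1) S → μ S = 0

/-- The semicouplings of `μ` and `ν`: Borel measures `q` on `ℝ^d × ℝ^d` whose first marginal is
at most `μ` and whose second marginal is equal to `ν`. -/
def semicouplings {d : ℕ} (μ ν : Measure (EuclideanSpace ℝ (Fin d))) :
    Set (Measure (EuclideanSpace ℝ (Fin d) × EuclideanSpace ℝ (Fin d))) :=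
  {q | q.map Prod.fst ≤ μ ∧ q.map Prod.snd = ν}

/-- The total cost `∫ ϑ(|x - y|) dq(x, y) ∈ [0, ∞]`, for `ϑ` nonnegative on `[0, ∞)`. -/
noncomputable def transportCost {d : ℕ} (ϑ : ℝ → ℝ)
    (q : Measure (EuclideanSpace ℝ (Fin d) × EuclideanSpace ℝ (Fin d))) : ℝ≥0∞ :=
  ∫⁻ p, ENNReal.ofReal (ϑ ‖p.1 - p.2‖) ∂q

/-- The optimal cost: the infimum of the total cost over all semicouplings. -/
noncomputable def optimalCost {d : ℕ} (ϑ : ℝ → ℝ) (μ ν : Measure (EuclideanSpace ℝ (Fin d))) :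
    ℝ≥0∞ :=
  ⨅ q ∈ semicouplings μ ν, transportCost ϑ q

/-- `q` is an optimizer: a semicoupling that attains the infimum. -/
def IsOptimizer {d : ℕ} (ϑ : ℝ → ℝ) (μ ν : Measure (EuclideanSpace ℝ (Fin d)))
    (q : Measure (EuclideanSpace ℝ (Fin d) × EuclideanSpace ℝ (Fin d))) : Prop :=
  q ∈ semicouplings μ ν ∧ transportCost ϑ q = optimalCost ϑ μ ν

/-! Existence is the direct method. The marginal constraints make the set of semicouplings tight and
closed, hence weakly compact. A concave increasing `ϑ` is continuous on the open half-line and can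
only jump upwards at `0`, so the cost is an increasing limit of bounded continuous costs and
therefore weakly lower semicontinuous.

For the first marginal, let `ξ` be the part of `μ` left unused by an optimizer `q`. If some source
were farther from its target than a point of `ξ.support`, rerouting a little mass from near that
point would be cheaper. So `q`-almost every source is at most as far from its target as every point
of `ξ.support`, and source and target differ because `μ ⟂ₘ ν`. A source inside `ξ.support` would
thus be a nearest point of that set to some other point; such points form a `(d-1)`-rectifiable set,
which `μ` does not charge. Hence `q` uses none of `μ` on `ξ.support` and all of it elsewhere
(`IsOptimizer.map_fst_eq_restrict`). Optimizers form a convex set, and the average of two indicator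
densities is again an indicator only if they agree almost everywhere, so `B` is common to all
optimizers.

Under strict concavity, swapping targets shows that the off-diagonal part of `q.support` is monotone
for the cost. Near a source with two targets, the costs to these targets grow at different rates in
some direction, and monotonicity then confines such sources to countably many Lipschitz graphs
(`isRectifiableSet_of_monotone`). Almost every source thus has one target, so every optimizer is
carried by a graph. Applied to the average of two optimizers, this puts both on the same graph over
the same first marginal, so they coincide. -/

open Filter Topology

/-! ### Countable unions, cone conditions and localization for rectifiable sets. -/

section Rectifiable

variable {d : ℕ}

theorem IsRectifiableSet.mono {m : ℕ} {S S' : Set (EuclideanSpace ℝ (Fin d))}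
    (h : IsRectifiableSet m S') (hS : S ⊆ S') : IsRectifiableSet m S := by
  obtain ⟨f, hf, hcov⟩ := h
  exact ⟨f, hf, hS.trans hcov⟩

theorem IsRectifiableSet.iUnion {m : ℕ} {S : ℕ → Set (EuclideanSpace ℝ (Fin d))}
    (h : ∀ n, IsRectifiableSet m (S n)) : IsRectifiableSet m (⋃ n, S n) := by
  choose f hf hcov using h
  refine ⟨fun k => f k.unpair.1 k.unpair.2, fun k => hf _ _, ?_⟩
  intro x hx
  obtain ⟨n, hn⟩ := mem_iUnion.1 hx
  obtain ⟨k, hk⟩ := mem_iUnion.1 (hcov n hn)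
  refine mem_iUnion.2 ⟨Nat.pair n k, ?_⟩
  simpa using hk

theorem isRectifiableSet_empty (m : ℕ) : IsRectifiableSet m (∅ : Set (EuclideanSpace ℝ (Fin d))) :=
  ⟨fun _ _ => 0, fun _ => ⟨0, LipschitzWith.const 0⟩, empty_subset _⟩

theorem IsRectifiableSet.biUnion {ι : Type*} {m : ℕ} {t : Set ι} (ht : t.Countable)
    {S : ι → Set (EuclideanSpace ℝ (Fin d))} (h : ∀ i ∈ t, IsRectifiableSet m (S i)) :
    IsRectifiableSet m (⋃ i ∈ t, S i) := by
  rcases t.eq_empty_or_nonempty with rfl | hne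
  · simpa using isRectifiableSet_empty m
  obtain ⟨g, rfl⟩ := ht.exists_eq_range hne
  rw [biUnion_range]
  exact IsRectifiableSet.iUnion fun n => h _ (mem_range_self n)

/-- A set on which some Lipschitz map to `ℝ^m` is injective with Lipschitz inverse is
`m`-rectifiable. -/
theorem isRectifiableSet_of_dist_le {m : ℕ} {A : Set (EuclideanSpace ℝ (Fin d))}
    (π : EuclideanSpace ℝ (Fin d) → EuclideanSpace ℝ (Fin m)) (K : ℝ≥0)
    (h : ∀ x ∈ A, ∀ x' ∈ A, dist x x' ≤ K * dist (π x) (π x')) : IsRectifiableSet m A := by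
  have hinj : InjOn π A := by
    intro x hx x' hx' hxx
    have := h x hx x' hx'
    rw [hxx, dist_self, mul_zero] at this
    exact dist_le_zero.1 this
  have hlip : LipschitzOnWith K (Function.invFunOn π A) (π '' A) := by
    apply LipschitzOnWith.of_dist_le_mul
    rintro _ ⟨x, hx, rfl⟩ _ ⟨x', hx', rfl⟩
    rw [hinj.leftInvOn_invFunOn hx, hinj.leftInvOn_invFunOn hx']
    exact h x hx x' hx'
  -- Rectifiability asks for maps defined on all of `ℝ^m`, so the inverse is extended from `π '' A`.
  obtain ⟨g, hg, hgeq⟩ := hlip.extend_finite_dimension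
  refine ⟨fun _ => g, fun _ => ⟨_, hg⟩, fun x hx => mem_iUnion.2 ⟨0, π x, ?_⟩⟩
  exact (hgeq (mem_image_of_mem π hx)).symm.trans (hinj.leftInvOn_invFunOn hx)

/-- A set whose difference vectors avoid a cone around the unit vector `e` is a Lipschitz graph
over the hyperplane orthogonal to `e`. -/
theorem isRectifiableSet_of_cone {A : Set (EuclideanSpace ℝ (Fin d))}
    {e : EuclideanSpace ℝ (Fin d)} (he : ‖e‖ = 1) {ε : ℝ} (hε : 0 < ε)
    (h : ∀ x ∈ A, ∀ x' ∈ A, ε * ‖x - x'‖ ≤ ‖(x - x') - ‖x - x'‖ • e‖) :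
    IsRectifiableSet (d - 1) A := by
  have he0 : e ≠ 0 := by rintro rfl; simp at he
  have hd : d ≠ 0 := by
    rintro rfl
    exact he0 (Subsingleton.elim _ _)
  have : Fact (Module.finrank ℝ (EuclideanSpace ℝ (Fin d)) = (d - 1) + 1) :=
    ⟨by rw [finrank_euclideanSpace_fin]; omega⟩
  let φ := (OrthonormalBasis.fromOrthogonalSpanSingleton (𝕜 := ℝ) (d - 1) he0).repr
  let P := (ℝ ∙ e)ᗮ.orthogonalProjectionOnto
  have key : ∀ v : EuclideanSpace ℝ (Fin d), ‖v‖ ^ 2 = ‖P v‖ ^ 2 + (inner ℝ e v) ^ 2 := by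
    intro v
    have h1 := Submodule.norm_sq_eq_add_norm_sq_projection v (ℝ ∙ e)
    have h2 : ‖(ℝ ∙ e).orthogonalProjectionOnto v‖ = |inner ℝ e v| := by
      rw [← Submodule.norm_coe, Submodule.coe_orthogonalProjectionOnto_apply,
        Submodule.starProjection_unit_singleton ℝ he, norm_smul, he]
      simp
    rw [h1, h2, sq_abs]
    ring
  refine isRectifiableSet_of_dist_le (fun x => φ (P x)) (2 / ε ^ 2).toNNReal fun x hx x' hx' => ?_
  rw [Real.coe_toNNReal _ (by positivity), φ.dist_map, dist_eq_norm, dist_eq_norm, ← map_sub]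
  have hx1 := h x hx x' hx'
  -- The hypothesis is symmetric in the two points, so `v` avoids the cones around both `e` and
  -- `-e`.
  have hx2 := h x' hx' x hx
  rw [norm_sub_rev x' x, ← neg_sub x x'] at hx2
  generalize x - x' = v at hx1 hx2 ⊢
  have hk := key v
  have e1 : ‖v - ‖v‖ • e‖ ^ 2 = 2 * ‖v‖ ^ 2 - 2 * ‖v‖ * inner ℝ e v := by
    rw [norm_sub_sq_real, real_inner_smul_right, norm_smul, he, real_inner_comm]
    simp only [norm_norm]
    ring
  have e2 : ‖-v - ‖v‖ • e‖ ^ 2 = 2 * ‖v‖ ^ 2 + 2 * ‖v‖ * inner ℝ e v := by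
    rw [norm_sub_sq_real, real_inner_smul_right, norm_smul, he, inner_neg_left, real_inner_comm,
      norm_neg]
    simp only [norm_norm]
    ring
  rcases (norm_nonneg v).eq_or_lt with hv | hv
  · rw [← hv]; positivity
  have f1 : (ε * ‖v‖) ^ 2 ≤ 2 * ‖v‖ ^ 2 - 2 * ‖v‖ * inner ℝ e v :=
    e1 ▸ pow_le_pow_left₀ (by positivity) hx1 2
  have f2 : (ε * ‖v‖) ^ 2 ≤ 2 * ‖v‖ ^ 2 + 2 * ‖v‖ * inner ℝ e v :=
    e2 ▸ pow_le_pow_left₀ (by positivity) hx2 2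
  have g1 : ε ^ 2 * ‖v‖ / 2 ≤ ‖v‖ - inner ℝ e v := by
    refine le_of_mul_le_mul_left ?_ (show 0 < 2 * ‖v‖ by positivity)
    linarith
  have g2 : ε ^ 2 * ‖v‖ / 2 ≤ ‖v‖ + inner ℝ e v := by
    refine le_of_mul_le_mul_left ?_ (show 0 < 2 * ‖v‖ by positivity)
    linarith
  -- The right-hand sides of `g1` and `g2` multiply to `‖v‖² - ⟪e, v⟫² = ‖P v‖²`.
  have g3 : (ε ^ 2 * ‖v‖ / 2) ^ 2 ≤ ‖P v‖ ^ 2 := by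
    have := mul_le_mul g1 g2 (by positivity) (le_trans (by positivity) g1)
    linarith
  have g4 : ε ^ 2 * ‖v‖ / 2 ≤ ‖P v‖ := le_of_sq_le_sq g3 (norm_nonneg _)
  rw [div_mul_eq_mul_div, le_div_iff₀ (by positivity)]
  linarith

/-- Second countability reduces the cover to countably many neighbourhoods. Carrying the targets in
`W` as extra coordinates allows them to be frozen near a limit point together with the source. -/
theorem isRectifiableSet_image_fst_of_locally {W : Type*} [TopologicalSpace W]
    [SecondCountableTopology W] {m : ℕ} {G : Set (EuclideanSpace ℝ (Fin d) × W)}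
    (h : ∀ p ∈ G, ∃ N ∈ 𝓝 p, IsRectifiableSet m (Prod.fst '' (G ∩ N))) :
    IsRectifiableSet m (Prod.fst '' G) := by
  choose! N hN hrect using h
  obtain ⟨t, htG, htc, hcov⟩ := TopologicalSpace.countable_cover_nhdsWithin
    (fun p hp => mem_nhdsWithin_of_mem_nhds (hN p hp))
  refine (IsRectifiableSet.biUnion htc fun p hp => hrect p (htG hp)).mono ?_
  rintro _ ⟨p, hp, rfl⟩
  obtain ⟨i, hi, hpi⟩ := mem_iUnion₂.1 (hcov hp)
  exact mem_iUnion₂.2 ⟨i, hi, p, ⟨hp, hpi⟩, rfl⟩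

end Rectifiable

/-! ### Strict differentiability of the norm away from the origin. -/

section Norm

variable {E : Type*} [NormedAddCommGroup E] [InnerProductSpace ℝ E]

/-- The identity `‖a‖ - ‖b‖ = ⟪(a + b) / (‖a‖ + ‖b‖), a - b⟫` is exact, and the vector on the left
of the inner product tends to `h / ‖h‖` as `a` and `b` tend to `h`. -/
theorem eventually_abs_norm_sub_sub_inner_le {h : E} (hh : h ≠ 0) {ε : ℝ} (hε : 0 < ε) :
    ∀ᶠ p : E × E in 𝓝 (h, h),
      |‖p.1‖ - ‖p.2‖ - inner ℝ (‖h‖⁻¹ • h) (p.1 - p.2)| ≤ ε * ‖p.1 - p.2‖ := by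
  have hc : ContinuousAt (fun p : E × E => (‖p.1‖ + ‖p.2‖)⁻¹ • (p.1 + p.2)) (h, h) := by
    refine ContinuousAt.smul (ContinuousAt.inv₀ (by fun_prop) ?_) (by fun_prop)
    have := norm_pos_iff.2 hh
    simp only
    positivity
  have hval : (‖h‖ + ‖h‖)⁻¹ • (h + h) = ‖h‖⁻¹ • h := by
    rw [← two_mul, ← two_smul ℝ h, smul_smul, mul_inv]
    congr 1
    field_simp
  have h1 : ∀ᶠ p : E × E in 𝓝 (h, h), 0 < ‖p.1‖ + ‖p.2‖ := by
    refine ContinuousAt.eventually_lt continuousAt_const (by fun_prop) ?_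
    have := norm_pos_iff.2 hh
    simp only
    positivity
  have h2 := Metric.tendsto_nhds.1 hc.tendsto ε hε
  filter_upwards [h1, h2] with p hp1 hp2
  rw [dist_eq_norm, hval] at hp2
  have heq : ‖p.1‖ - ‖p.2‖ - inner ℝ (‖h‖⁻¹ • h) (p.1 - p.2) =
      inner ℝ ((‖p.1‖ + ‖p.2‖)⁻¹ • (p.1 + p.2) - ‖h‖⁻¹ • h) (p.1 - p.2) := by
    rw [inner_sub_left, real_inner_smul_left (p.1 + p.2), inner_sub_right (p.1 + p.2),
      inner_add_left, inner_add_left, real_inner_self_eq_norm_sq, real_inner_self_eq_norm_sq,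
      real_inner_comm p.1 p.2]
    field_simp
    ring
  rw [heq]
  exact (abs_real_inner_le_norm _ _).trans (by gcongr)

end Norm

/-! ### Directions in which the costs to two targets grow at different rates. -/

section NormIncrement

variable {E : Type*} [NormedAddCommGroup E] [InnerProductSpace ℝ E]

theorem exists_nhds_abs_norm_increment_le {x₀ y₀ : E} (h : x₀ ≠ y₀) {ε : ℝ} (hε : 0 < ε) :
    ∃ V ∈ 𝓝 x₀, ∃ W ∈ 𝓝 y₀, ∀ x ∈ V, ∀ x' ∈ V, ∀ y ∈ W,
      |‖x - y‖ - ‖x' - y‖ - inner ℝ (‖x₀ - y₀‖⁻¹ • (x₀ - y₀)) (x - x')| ≤ ε * ‖x - x'‖ := by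
  have hc : ContinuousAt (fun p : (E × E) × E => (p.1.1 - p.2, p.1.2 - p.2)) ((x₀, x₀), y₀) := by
    fun_prop
  have h1 := hc.eventually (eventually_abs_norm_sub_sub_inner_le (sub_ne_zero.2 h) hε)
  obtain ⟨S, hS, W, hW, hSW⟩ := mem_nhds_prod_iff.1 h1
  obtain ⟨V₁, hV₁, V₂, hV₂, hV⟩ := mem_nhds_prod_iff.1 hS
  refine ⟨V₁ ∩ V₂, inter_mem hV₁ hV₂, W, hW, fun x hx x' hx' y hy => ?_⟩
  have := hSW (mk_mem_prod (hV (mk_mem_prod hx.1 hx'.2)) hy)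
  simpa using this

theorem exists_nhds_ne {E : Type*} [TopologicalSpace E] [T2Space E] {x₀ y₀ : E} (h : x₀ ≠ y₀) :
    ∃ V ∈ 𝓝 x₀, ∃ W ∈ 𝓝 y₀, ∀ x ∈ V, ∀ y ∈ W, x ≠ y := by
  obtain ⟨V, W, hV, hW, hxV, hyW, hd⟩ := t2_separation h
  exact ⟨V, hV.mem_nhds hxV, W, hW.mem_nhds hyW, fun x hx y hy hxy =>
    disjoint_left.1 hd hx (hxy ▸ hy)⟩

/-- For `r < p < m < t < s`, let `σ` and `τ` be the chord slopes over `[p, m]` and `[m, t]`. Strict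
concavity separates them, and concavity compares them with all chords left of `p` and right of `t`.
No differentiability of `ϑ` is needed. -/
theorem StrictConcaveOn.exists_nhds_slope_gap {ϑ : ℝ → ℝ} (hmono : StrictMonoOn ϑ (Ici 0))
    (hconc : StrictConcaveOn ℝ (Ici 0) ϑ) {r s : ℝ} (hr : 0 < r) (hrs : r < s) :
    ∃ σ τ : ℝ, 0 < τ ∧ τ < σ ∧ ∃ I ∈ 𝓝 r, ∃ J ∈ 𝓝 s,
      (∀ a ∈ I, ∀ a' ∈ I, a < a' → σ * (a' - a) ≤ ϑ a' - ϑ a) ∧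
      (∀ b ∈ J, ∀ b' ∈ J, b < b' → ϑ b' - ϑ b ≤ τ * (b' - b)) := by
  obtain ⟨p, hrp, hps⟩ := exists_between hrs
  obtain ⟨m, hpm, hms⟩ := exists_between hps
  obtain ⟨t, hmt, hts⟩ := exists_between hms
  have hp : (0 : ℝ) < p := hr.trans hrp
  have hm : (0 : ℝ) < m := hp.trans hpm
  have ht : (0 : ℝ) < t := hm.trans hmt
  refine ⟨(ϑ m - ϑ p) / (m - p), (ϑ t - ϑ m) / (t - m), ?_,
    hconc.slope_anti_adjacent hp.le ht.le hpm hmt, Ioo 0 p, Ioo_mem_nhds hr hrp, Ioi t,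
    Ioi_mem_nhds hts, ?_, ?_⟩
  · exact div_pos (sub_pos.2 (hmono hm.le ht.le hmt)) (sub_pos.2 hmt)
  · intro a ha a' ha' haa
    rw [← le_div_iff₀ (sub_pos.2 haa)]
    exact (hconc.concaveOn.slope_anti_adjacent ha'.1.le hm.le ha'.2 hpm).trans
      (hconc.concaveOn.slope_anti_adjacent ha.1.le hp.le haa ha'.2)
  · intro b hb b' hb' hbb
    have hb0 : (0 : ℝ) < b := ht.trans hb
    rw [← div_le_iff₀ (sub_pos.2 hbb)]
    exact (hconc.concaveOn.slope_anti_adjacent ht.le (hb0.trans hbb).le hb hbb).trans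
      (hconc.concaveOn.slope_anti_adjacent hm.le hb0.le hmt hb)

/-- The increment of `ϑ ‖· - y‖` along a segment in a direction close to `e` is larger for `y`
near `y₁` than for `y` near `y₂`. -/
def SeparatesIncrements (ϑ : ℝ → ℝ) (x₀ y₁ y₂ : E) : Prop :=
  ∃ e : E, ‖e‖ = 1 ∧ ∃ ε > 0, ∃ V ∈ 𝓝 x₀, ∃ W₁ ∈ 𝓝 y₁, ∃ W₂ ∈ 𝓝 y₂,
    ∀ x ∈ V, ∀ x' ∈ V, ∀ y ∈ W₁, ∀ y' ∈ W₂, ‖(x - x') - ‖x - x'‖ • e‖ < ε * ‖x - x'‖ →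
      ϑ ‖x - y'‖ - ϑ ‖x' - y'‖ < ϑ ‖x - y‖ - ϑ ‖x' - y‖

theorem SeparatesIncrements.symm {ϑ : ℝ → ℝ} {x₀ y₁ y₂ : E}
    (h : SeparatesIncrements ϑ x₀ y₁ y₂) : SeparatesIncrements ϑ x₀ y₂ y₁ := by
  obtain ⟨e, he, ε, hε, V, hV, W₁, hW₁, W₂, hW₂, h⟩ := h
  refine ⟨-e, by rwa [norm_neg], ε, hε, V, hV, W₂, hW₂, W₁, hW₁, ?_⟩
  intro x hx x' hx' y hy y' hy' hlt
  have hneg : (x' - x) - ‖x' - x‖ • e = -((x - x') - ‖x - x'‖ • -e) := by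
    rw [norm_sub_rev x' x, smul_neg]
    abel
  have := h x' hx' x hx y' hy' y hy (by rwa [hneg, norm_neg, norm_sub_rev x' x])
  linarith

theorem abs_inner_sub_smul_le {u v e : E} (hu : ‖u‖ = 1) {ε : ℝ}
    (h : ‖v - ‖v‖ • e‖ < ε * ‖v‖) : |inner ℝ u v - ‖v‖ * inner ℝ u e| ≤ ε * ‖v‖ := by
  rw [← real_inner_smul_right, ← inner_sub_right]
  refine (abs_real_inner_le_norm _ _).trans ?_
  rw [hu, one_mul]
  exact h.le

theorem pos_of_norm_sub_smul_lt {v e : E} {ε : ℝ} (hε : 0 < ε)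
    (h : ‖v - ‖v‖ • e‖ < ε * ‖v‖) : 0 < ‖v‖ :=
  pos_of_mul_pos_right ((norm_nonneg _).trans_lt h) hε.le

/-- Both targets lie on one ray from `x₀`. Moving along this ray changes both distances by about the
same amount, but strict concavity makes the cost to the nearer target change faster. -/
theorem separatesIncrements_of_direction_eq {ϑ : ℝ → ℝ} (hmono : StrictMonoOn ϑ (Ici 0))
    (hconc : StrictConcaveOn ℝ (Ici 0) ϑ) {x₀ y₁ y₂ : E} (h₁ : x₀ ≠ y₁) (h₂ : x₀ ≠ y₂)
    (hu : ‖x₀ - y₁‖⁻¹ • (x₀ - y₁) = ‖x₀ - y₂‖⁻¹ • (x₀ - y₂))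
    (hlt : ‖x₀ - y₁‖ < ‖x₀ - y₂‖) : SeparatesIncrements ϑ x₀ y₁ y₂ := by
  obtain ⟨σ, τ, hτ, hστ, I, hI, J, hJ, hσ', hτ'⟩ :=
    hconc.exists_nhds_slope_gap hmono (norm_pos_iff.2 (sub_ne_zero.2 h₁)) hlt
  -- Inside the cone both distance increments lie within `(1 ± 2ε) * s`, where `s = ‖x - x'‖`. This
  -- `ε` gives `σ * (1 - 2ε) - τ * (1 + 2ε) = (σ - τ) / 2 > 0`, and `ε ≤ 1/4` keeps the increments
  -- positive.
  have hε : 0 < (σ - τ) / (4 * (σ + τ)) := div_pos (by linarith) (by linarith)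
  have hεmul : (σ - τ) / (4 * (σ + τ)) * (σ + τ) = (σ - τ) / 4 := by
    have : σ + τ ≠ 0 := by linarith
    field_simp
  have hε4 : (σ - τ) / (4 * (σ + τ)) ≤ 1 / 4 := by
    rw [div_le_div_iff₀ (by linarith) (by norm_num)]
    linarith
  generalize (σ - τ) / (4 * (σ + τ)) = ε at hε hεmul hε4
  obtain ⟨V₁, hV₁, W₁, hW₁, hinc₁⟩ := exists_nhds_abs_norm_increment_le h₁ hε
  obtain ⟨V₂, hV₂, W₂, hW₂, hinc₂⟩ := exists_nhds_abs_norm_increment_le h₂ hε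
  have hc₁ : ContinuousAt (fun p : E × E => ‖p.1 - p.2‖) (x₀, y₁) := by fun_prop
  have hc₂ : ContinuousAt (fun p : E × E => ‖p.1 - p.2‖) (x₀, y₂) := by fun_prop
  obtain ⟨A₁, hA₁, B₁, hB₁, hAB₁⟩ := mem_nhds_prod_iff.1 (hc₁.preimage_mem_nhds hI)
  obtain ⟨A₂, hA₂, B₂, hB₂, hAB₂⟩ := mem_nhds_prod_iff.1 (hc₂.preimage_mem_nhds hJ)
  have hu1 : ‖‖x₀ - y₁‖⁻¹ • (x₀ - y₁)‖ = 1 := norm_smul_inv_norm (𝕜 := ℝ) (sub_ne_zero.2 h₁)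
  refine ⟨_, hu1, ε, hε, (V₁ ∩ V₂) ∩ (A₁ ∩ A₂), inter_mem (inter_mem hV₁ hV₂) (inter_mem hA₁ hA₂),
    W₁ ∩ B₁, inter_mem hW₁ hB₁, W₂ ∩ B₂, inter_mem hW₂ hB₂, ?_⟩
  intro x hx x' hx' y hy y' hy' hcone
  have i1 := abs_le.1 (hinc₁ x hx.1.1 x' hx'.1.1 y hy.1)
  have i2 := abs_le.1 (hinc₂ x hx.1.2 x' hx'.1.2 y' hy'.1)
  rw [← hu] at i2
  have hin := abs_le.1 (abs_inner_sub_smul_le hu1 hcone)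
  rw [real_inner_self_eq_norm_sq, hu1] at hin
  have hs := pos_of_norm_sub_smul_lt hε hcone
  generalize inner ℝ (‖x₀ - y₁‖⁻¹ • (x₀ - y₁)) (x - x') = w at i1 i2 hin
  generalize ‖x - x'‖ = s at i1 i2 hin hs
  have hεs : ε * s ≤ 1 / 4 * s := by gcongr
  have j1 := hσ' _ (hAB₁ (mk_mem_prod hx'.2.1 hy.2)) _ (hAB₁ (mk_mem_prod hx.2.1 hy.2))
    (by dsimp only; linarith)
  have j2 := hτ' _ (hAB₂ (mk_mem_prod hx'.2.2 hy'.2)) _ (hAB₂ (mk_mem_prod hx.2.2 hy'.2))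
    (by dsimp only; linarith)
  dsimp only at j1 j2
  have k1 : σ * (s - 2 * (ε * s)) ≤ σ * (‖x - y‖ - ‖x' - y‖) :=
    mul_le_mul_of_nonneg_left (by linarith) (by linarith)
  have k2 : τ * (‖x - y'‖ - ‖x' - y'‖) ≤ τ * (s + 2 * (ε * s)) :=
    mul_le_mul_of_nonneg_left (by linarith) (by linarith)
  have k3 : τ * (s + 2 * (ε * s)) < σ * (s - 2 * (ε * s)) := by
    have : 0 < (σ - τ) * s := mul_pos (by linarith) hs
    have h4 : (ε * (σ + τ)) * s = (σ - τ) / 4 * s := by rw [hεmul]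
    linarith
  linarith

/-- Along the normalized difference of the two unit directions, one distance grows at rate `‖u₁ -
u₂‖ / 2` and the other shrinks at that rate. The two errors of `‖u₁ - u₂‖ / 8` do not change these
signs, so monotonicity of `ϑ` suffices. -/
theorem separatesIncrements_of_direction_ne {ϑ : ℝ → ℝ} (hmono : StrictMonoOn ϑ (Ici 0))
    {x₀ y₁ y₂ : E} (h₁ : x₀ ≠ y₁) (h₂ : x₀ ≠ y₂)
    (hu : ‖x₀ - y₁‖⁻¹ • (x₀ - y₁) ≠ ‖x₀ - y₂‖⁻¹ • (x₀ - y₂)) :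
    SeparatesIncrements ϑ x₀ y₁ y₂ := by
  have hu1 : ‖‖x₀ - y₁‖⁻¹ • (x₀ - y₁)‖ = 1 := norm_smul_inv_norm (𝕜 := ℝ) (sub_ne_zero.2 h₁)
  have hu2 : ‖‖x₀ - y₂‖⁻¹ • (x₀ - y₂)‖ = 1 := norm_smul_inv_norm (𝕜 := ℝ) (sub_ne_zero.2 h₂)
  have hδ := norm_pos_iff.2 (sub_ne_zero.2 hu)
  obtain ⟨V₁, hV₁, W₁, hW₁, hinc₁⟩ := exists_nhds_abs_norm_increment_le h₁
    (ε := ‖‖x₀ - y₁‖⁻¹ • (x₀ - y₁) - ‖x₀ - y₂‖⁻¹ • (x₀ - y₂)‖ / 8) (by positivity)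
  obtain ⟨V₂, hV₂, W₂, hW₂, hinc₂⟩ := exists_nhds_abs_norm_increment_le h₂
    (ε := ‖‖x₀ - y₁‖⁻¹ • (x₀ - y₁) - ‖x₀ - y₂‖⁻¹ • (x₀ - y₂)‖ / 8) (by positivity)
  generalize ‖x₀ - y₁‖⁻¹ • (x₀ - y₁) = u₁ at *
  generalize ‖x₀ - y₂‖⁻¹ • (x₀ - y₂) = u₂ at *
  have hsq : ‖u₁ - u₂‖ ^ 2 = 2 - 2 * inner ℝ u₁ u₂ := by
    rw [norm_sub_sq_real, hu1, hu2]; ring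
  have he1 : inner ℝ u₁ (‖u₁ - u₂‖⁻¹ • (u₁ - u₂)) = ‖u₁ - u₂‖ / 2 := by
    rw [real_inner_smul_right, inner_sub_right, real_inner_self_eq_norm_sq, hu1]
    field_simp
    linarith
  have he2 : inner ℝ u₂ (‖u₁ - u₂‖⁻¹ • (u₁ - u₂)) = -(‖u₁ - u₂‖ / 2) := by
    rw [real_inner_smul_right, inner_sub_right, real_inner_self_eq_norm_sq, hu2,
      real_inner_comm]
    field_simp
    linarith
  refine ⟨‖u₁ - u₂‖⁻¹ • (u₁ - u₂), norm_smul_inv_norm (𝕜 := ℝ) (sub_ne_zero.2 hu),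
    ‖u₁ - u₂‖ / 8, by positivity, V₁ ∩ V₂, inter_mem hV₁ hV₂, W₁, hW₁, W₂, hW₂, ?_⟩
  intro x hx x' hx' y hy y' hy' hcone
  have i1 := abs_le.1 (hinc₁ x hx.1 x' hx'.1 y hy)
  have i2 := abs_le.1 (hinc₂ x hx.2 x' hx'.2 y' hy')
  have hin1 := abs_le.1 (abs_inner_sub_smul_le hu1 hcone)
  have hin2 := abs_le.1 (abs_inner_sub_smul_le hu2 hcone)
  have hs := pos_of_norm_sub_smul_lt (by positivity) hcone
  rw [he1] at hin1
  rw [he2] at hin2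
  have hpos := mul_pos hδ hs
  have l1 : ϑ ‖x' - y‖ < ϑ ‖x - y‖ := hmono (norm_nonneg _) (norm_nonneg _) (by linarith)
  have l2 : ϑ ‖x - y'‖ < ϑ ‖x' - y'‖ := hmono (norm_nonneg _) (norm_nonneg _) (by linarith)
  linarith

theorem separatesIncrements {ϑ : ℝ → ℝ} (hmono : StrictMonoOn ϑ (Ici 0))
    (hconc : StrictConcaveOn ℝ (Ici 0) ϑ) {x₀ y₁ y₂ : E} (h₁ : x₀ ≠ y₁) (h₂ : x₀ ≠ y₂)
    (hne : y₁ ≠ y₂) : SeparatesIncrements ϑ x₀ y₁ y₂ := by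
  by_cases hu : ‖x₀ - y₁‖⁻¹ • (x₀ - y₁) = ‖x₀ - y₂‖⁻¹ • (x₀ - y₂)
  · rcases lt_trichotomy ‖x₀ - y₁‖ ‖x₀ - y₂‖ with h | h | h
    · exact separatesIncrements_of_direction_eq hmono hconc h₁ h₂ hu h
    · rw [h] at hu
      have := smul_right_injective E
        (inv_ne_zero (norm_ne_zero_iff.2 (sub_ne_zero.2 h₂))) hu
      exact absurd (sub_right_injective this) hne
    · exact (separatesIncrements_of_direction_eq hmono hconc h₂ h₁ hu.symm h).symm
  · exact separatesIncrements_of_direction_ne hmono h₁ h₂ hu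

end NormIncrement

/-! ### The two rectifiable exceptional sets. -/

section RectifiableApplications

variable {d : ℕ}

/-- The points of a set that are nearest points of some other point form a
`(d-1)`-rectifiable set. -/
theorem isRectifiableSet_nearest_points (U : Set (EuclideanSpace ℝ (Fin d))) :
    IsRectifiableSet (d - 1) {x | x ∈ U ∧ ∃ y, x ≠ y ∧ ∀ z ∈ U, ‖x - y‖ ≤ ‖z - y‖} := by
  let G : Set (EuclideanSpace ℝ (Fin d) × EuclideanSpace ℝ (Fin d)) :=
    {p | p.1 ∈ U ∧ p.1 ≠ p.2 ∧ ∀ z ∈ U, ‖p.1 - p.2‖ ≤ ‖z - p.2‖}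
  suffices IsRectifiableSet (d - 1) (Prod.fst '' G) by
    refine this.mono ?_
    rintro x ⟨hx, y, hxy, h⟩
    exact ⟨(x, y), ⟨hx, hxy, h⟩, rfl⟩
  refine isRectifiableSet_image_fst_of_locally ?_
  rintro ⟨x₀, y₀⟩ ⟨-, hne, -⟩
  obtain ⟨V, hV, W, hW, hinc⟩ := exists_nhds_abs_norm_increment_le hne (ε := 1 / 4) (by norm_num)
  have hu : ‖‖x₀ - y₀‖⁻¹ • (x₀ - y₀)‖ = 1 := norm_smul_inv_norm (𝕜 := ℝ) (sub_ne_zero.2 hne)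
  refine ⟨V ×ˢ W, prod_mem_nhds hV hW, isRectifiableSet_of_cone hu one_pos ?_⟩
  rintro _ ⟨⟨x, y⟩, ⟨⟨-, -, hmin⟩, hxV, hyW⟩, rfl⟩ _ ⟨⟨x', y'⟩, ⟨⟨hx', -, -⟩, hxV', -⟩, rfl⟩
  dsimp only at *
  have h1 := abs_le.1 (hinc x hxV x' hxV' y hyW)
  have h2 := hmin x' hx'
  rw [one_mul]
  refine le_of_sq_le_sq ?_ (norm_nonneg _)
  rw [norm_sub_sq_real (x - x'), real_inner_smul_right, norm_smul, hu, norm_norm, real_inner_comm]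
  -- As `x` is nearest to `y`, the increment `‖x - y‖ - ‖x' - y‖` is nonpositive, so the inner
  -- product is at most `‖x - x'‖ / 4`. The squared distance in the cone condition is then at least
  -- `3/2 * ‖x - x'‖²`.
  have h3 : ‖x - x'‖ * inner ℝ (‖x₀ - y₀‖⁻¹ • (x₀ - y₀)) (x - x') ≤
      ‖x - x'‖ * (1 / 4 * ‖x - x'‖) :=
    mul_le_mul_of_nonneg_left (by linarith) (norm_nonneg _)
  nlinarith [sq_nonneg ‖x - x'‖]

/-- The points from which mass is sent to two different targets by a plan that is monotone
off the diagonal form a `(d-1)`-rectifiable set. -/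
theorem isRectifiableSet_of_monotone {ϑ : ℝ → ℝ} (hmono : StrictMonoOn ϑ (Ici 0))
    (hconc : StrictConcaveOn ℝ (Ici 0) ϑ)
    {Γ : Set (EuclideanSpace ℝ (Fin d) × EuclideanSpace ℝ (Fin d))}
    (hdiag : ∀ p ∈ Γ, p.1 ≠ p.2)
    (hΓ : ∀ p ∈ Γ, ∀ p' ∈ Γ, p.1 ≠ p'.2 → p'.1 ≠ p.2 →
      ϑ ‖p.1 - p.2‖ + ϑ ‖p'.1 - p'.2‖ ≤ ϑ ‖p.1 - p'.2‖ + ϑ ‖p'.1 - p.2‖) :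
    IsRectifiableSet (d - 1) {x | ∃ y y', y ≠ y' ∧ (x, y) ∈ Γ ∧ (x, y') ∈ Γ} := by
  let E := EuclideanSpace ℝ (Fin d)
  let G : Set (E × (E × E)) := {p | p.2.1 ≠ p.2.2 ∧ (p.1, p.2.1) ∈ Γ ∧ (p.1, p.2.2) ∈ Γ}
  suffices IsRectifiableSet (d - 1) (Prod.fst '' G) by
    refine this.mono ?_
    rintro x ⟨y, y', h⟩
    exact ⟨(x, (y, y')), h, rfl⟩
  refine isRectifiableSet_image_fst_of_locally ?_
  rintro ⟨x₀, y₁, y₂⟩ ⟨hne, h₁, h₂⟩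
  obtain ⟨e, he, ε, hε, V, hV, W₁, hW₁, W₂, hW₂, hsep⟩ :=
    separatesIncrements hmono hconc (hdiag (x₀, y₁) h₁) (hdiag (x₀, y₂) h₂) hne
  -- Monotonicity is available only when the swapped pairs are off the diagonal; these
  -- neighbourhoods guarantee it.
  obtain ⟨A₁, hA₁, B₁, hB₁, hAB₁⟩ := exists_nhds_ne (hdiag (x₀, y₁) h₁)
  obtain ⟨A₂, hA₂, B₂, hB₂, hAB₂⟩ := exists_nhds_ne (hdiag (x₀, y₂) h₂)
  refine ⟨(V ∩ (A₁ ∩ A₂)) ×ˢ ((W₁ ∩ B₁) ×ˢ (W₂ ∩ B₂)),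
    prod_mem_nhds (inter_mem hV (inter_mem hA₁ hA₂))
      (prod_mem_nhds (inter_mem hW₁ hB₁) (inter_mem hW₂ hB₂)),
    isRectifiableSet_of_cone he hε ?_⟩
  -- Only the target of `x` near `y₁` and the target of `x'` near `y₂` matter. If `x - x'` lay in
  -- the cone, swapping these two would lower the cost.
  rintro _ ⟨⟨x, y, z⟩, ⟨⟨-, hxy, -⟩, ⟨hxV, hxA₁, hxA₂⟩, ⟨hyW, hyB⟩, -⟩, rfl⟩
    _ ⟨⟨x', z', y'⟩, ⟨⟨-, -, hxy'⟩, ⟨hxV', hxA₁', hxA₂'⟩, -, ⟨hyW', hyB'⟩⟩, rfl⟩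
  by_contra! hcone
  have h3 := hsep x hxV x' hxV' y hyW y' hyW' hcone
  have h4 := hΓ _ hxy _ hxy' (hAB₂ x hxA₂ y' hyB') (hAB₁ x' hxA₁' y hyB)
  dsimp only at h4
  linarith

end RectifiableApplications

/-! ### Weakly closed constraints and weakly lower semicontinuous functionals. -/

section WeakConvergence

open scoped BoundedContinuousFunction

variable {Ω : Type*} [MeasurableSpace Ω] [TopologicalSpace Ω]

/-- Indicators of closed sets are limits of bounded continuous functions, and inner regularity
passes from closed to measurable sets. -/
theorem measure_le_of_forall_lintegral_le [HasOuterApproxClosed Ω] [BorelSpace Ω]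
    {m μ : Measure Ω} [IsFiniteMeasure m] [IsFiniteMeasure μ] [m.WeaklyRegular]
    (h : ∀ f : Ω →ᵇ ℝ≥0, ∫⁻ x, f x ∂m ≤ ∫⁻ x, f x ∂μ) : m ≤ μ := by
  have hclosed : ∀ F : Set Ω, IsClosed F → m F ≤ μ F := fun F hF =>
    le_of_tendsto_of_tendsto' (HasOuterApproxClosed.tendsto_lintegral_apprSeq hF m)
      (HasOuterApproxClosed.tendsto_lintegral_apprSeq hF μ) fun n => h _
  refine Measure.le_iff.2 fun s hs => ?_
  rw [hs.measure_eq_iSup_isClosed_of_ne_top (measure_ne_top m s)]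
  exact iSup₂_le fun F hFs => iSup_le fun hF => (hclosed F hF).trans (measure_mono hFs)

theorem isClosed_setOf_finiteMeasure_le [HasOuterApproxClosed Ω] [BorelSpace Ω]
    [∀ m : FiniteMeasure Ω, (m : Measure Ω).WeaklyRegular] (μ : Measure Ω) [IsFiniteMeasure μ] :
    IsClosed {m : FiniteMeasure Ω | (m : Measure Ω) ≤ μ} := by
  have : {m : FiniteMeasure Ω | (m : Measure Ω) ≤ μ} =
      ⋂ f : Ω →ᵇ ℝ≥0, {m : FiniteMeasure Ω | ∫⁻ x, f x ∂(m : Measure Ω) ≤ ∫⁻ x, f x ∂μ} := by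
    ext m
    simp only [mem_ofPred_eq, mem_iInter]
    exact ⟨fun h f => lintegral_mono' h le_rfl, fun h => measure_le_of_forall_lintegral_le h⟩
  rw [this]
  exact isClosed_iInter fun f =>
    isClosed_le (FiniteMeasure.continuous_lintegral_boundedContinuousFunction f) continuous_const

theorem lowerSemicontinuous_lintegral_iSup [OpensMeasurableSpace Ω] {f : ℕ → Ω →ᵇ ℝ≥0}
    (hf : ∀ x, Monotone fun n => f n x) :
    LowerSemicontinuous fun q : FiniteMeasure Ω =>
      ∫⁻ x, ⨆ n, (f n x : ℝ≥0∞) ∂(q : Measure Ω) := by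
  have : (fun q : FiniteMeasure Ω => ∫⁻ x, ⨆ n, (f n x : ℝ≥0∞) ∂(q : Measure Ω)) =
      fun q : FiniteMeasure Ω => ⨆ n, ∫⁻ x, (f n x : ℝ≥0∞) ∂(q : Measure Ω) := by
    funext q
    refine lintegral_iSup (fun n => ?_) fun n k hnk x => ?_
    · exact (ENNReal.continuous_coe.comp (f n).continuous).measurable
    · exact ENNReal.coe_le_coe.2 (hf x hnk)
  rw [this]
  exact lowerSemicontinuous_iSup fun n =>
    (FiniteMeasure.continuous_lintegral_boundedContinuousFunction (f n)).lowerSemicontinuous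

end WeakConvergence

/-! ### Lower semicontinuity of the transport cost. -/

section Cost

variable {ϑ : ℝ → ℝ}

/-- Bounded continuous approximation from below of a function that may jump at `0`. -/
noncomputable def truncatedCost (ϑ : ℝ → ℝ) (n : ℕ) (r : ℝ) : ℝ :=
  ϑ 0 + min (ϑ r - ϑ 0) n * min 1 (n * r)

/-- At `0` the factor `min 1 (n * r)` removes a possible jump, by squeezing between `ϑ 0` and `ϑ 0 +
n * (n * r)`. Elsewhere a concave function is continuous in the interior of its domain. -/
theorem continuousOn_truncatedCost (hmono : MonotoneOn ϑ (Ici 0)) (hconc : ConcaveOn ℝ (Ici 0) ϑ)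
    (n : ℕ) : ContinuousOn (truncatedCost ϑ n) (Ici 0) := by
  intro r hr
  rcases (mem_Ici.1 hr).eq_or_lt with rfl | hr0
  · have h0 : truncatedCost ϑ n 0 = ϑ 0 := by simp [truncatedCost]
    rw [ContinuousWithinAt, h0]
    have hlim : Tendsto (fun r : ℝ => ϑ 0 + n * (n * r)) (𝓝[Ici 0] 0) (𝓝 (ϑ 0)) := by
      have : Continuous fun r : ℝ => ϑ 0 + n * (n * r) := by fun_prop
      simpa using (this.tendsto 0).mono_left nhdsWithin_le_nhds
    refine tendsto_of_tendsto_of_tendsto_of_le_of_le' tendsto_const_nhds hlim ?_ ?_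
    all_goals
      filter_upwards [self_mem_nhdsWithin] with t ht
      have h1 : 0 ≤ ϑ t - ϑ 0 := sub_nonneg.2 (hmono self_mem_Ici ht ht)
      have h2 : (0 : ℝ) ≤ n * t := mul_nonneg n.cast_nonneg ht
      have h3 : 0 ≤ min (ϑ t - ϑ 0) n := le_min h1 n.cast_nonneg
      have h4 : 0 ≤ min 1 (n * t) := le_min zero_le_one h2
      unfold truncatedCost
    · have := mul_nonneg h3 h4
      linarith
    · have := mul_le_mul (min_le_right (ϑ t - ϑ 0) (n : ℝ)) (min_le_right 1 (n * t)) h4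
        n.cast_nonneg
      linarith
  · have hc : ContinuousAt ϑ r := by
      have := hconc.continuousOn_interior
      rw [interior_Ici] at this
      exact this.continuousAt (Ioi_mem_nhds hr0)
    unfold truncatedCost
    exact ContinuousAt.continuousWithinAt (by fun_prop)

theorem truncatedCost_nonneg (hnonneg : ∀ t ∈ Ici (0 : ℝ), 0 ≤ ϑ t)
    (hmono : MonotoneOn ϑ (Ici 0)) (n : ℕ) {r : ℝ} (hr : 0 ≤ r) : 0 ≤ truncatedCost ϑ n r :=
  add_nonneg (hnonneg 0 self_mem_Ici)
    (mul_nonneg (le_min (sub_nonneg.2 (hmono self_mem_Ici hr hr)) n.cast_nonneg)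
      (le_min zero_le_one (mul_nonneg n.cast_nonneg hr)))

theorem truncatedCost_le (hmono : MonotoneOn ϑ (Ici 0)) (n : ℕ) {r : ℝ} (hr : 0 ≤ r) :
    truncatedCost ϑ n r ≤ ϑ 0 + n := by
  have h1 : 0 ≤ ϑ r - ϑ 0 := sub_nonneg.2 (hmono self_mem_Ici hr hr)
  have := mul_le_mul (min_le_right (ϑ r - ϑ 0) (n : ℝ)) (min_le_left 1 (n * r))
    (le_min zero_le_one (mul_nonneg n.cast_nonneg hr)) n.cast_nonneg
  unfold truncatedCost
  linarith

theorem truncatedCost_mono (hmono : MonotoneOn ϑ (Ici 0)) {r : ℝ} (hr : 0 ≤ r) :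
    Monotone fun n => truncatedCost ϑ n r := by
  intro n k hnk
  have h1 : 0 ≤ ϑ r - ϑ 0 := sub_nonneg.2 (hmono self_mem_Ici hr hr)
  have hnk' : (n : ℝ) ≤ k := Nat.cast_le.2 hnk
  refine add_le_add_right (mul_le_mul (min_le_min_left _ hnk')
    (min_le_min_left _ (mul_le_mul_of_nonneg_right hnk' hr))
    (le_min zero_le_one (mul_nonneg n.cast_nonneg hr)) (le_min h1 k.cast_nonneg)) _

theorem truncatedCost_le_self (hmono : MonotoneOn ϑ (Ici 0)) (n : ℕ) {r : ℝ} (hr : 0 ≤ r) :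
    truncatedCost ϑ n r ≤ ϑ r := by
  have h1 : 0 ≤ ϑ r - ϑ 0 := sub_nonneg.2 (hmono self_mem_Ici hr hr)
  have := mul_le_mul (min_le_left (ϑ r - ϑ 0) (n : ℝ)) (min_le_left 1 (n * r))
    (le_min zero_le_one (mul_nonneg n.cast_nonneg hr)) h1
  unfold truncatedCost
  linarith

theorem exists_truncatedCost_eq {r : ℝ} (hr : 0 ≤ r) : ∃ n : ℕ, truncatedCost ϑ n r = ϑ r := by
  rcases hr.eq_or_lt with rfl | hr
  · exact ⟨0, by simp [truncatedCost]⟩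
  · obtain ⟨n, hn⟩ := exists_nat_ge (max (ϑ r - ϑ 0) r⁻¹)
    refine ⟨n, ?_⟩
    have h1 : 1 ≤ n * r := by
      rw [← inv_mul_cancel₀ hr.ne']
      exact mul_le_mul_of_nonneg_right ((le_max_right _ _).trans hn) hr.le
    rw [truncatedCost, min_eq_left ((le_max_left _ _).trans hn), min_eq_left h1]
    ring

variable {d : ℕ}

theorem MonotoneOn.measurable_comp_nonneg {X : Type*} [MeasurableSpace X]
    (hmono : MonotoneOn ϑ (Ici 0)) {g : X → ℝ} (hg : Measurable g) (h0 : ∀ x, 0 ≤ g x) :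
    Measurable fun x => ϑ (g x) := by
  have h1 : Monotone fun r : ℝ => ϑ (max r 0) := fun a b hab =>
    hmono (mem_Ici.2 (le_max_right _ _)) (mem_Ici.2 (le_max_right _ _)) (max_le_max_right 0 hab)
  have h2 := h1.measurable.comp hg
  have h3 : (fun x => ϑ (g x)) = (fun r : ℝ => ϑ (max r 0)) ∘ g := by
    funext x
    simp [h0 x]
  exact h3 ▸ h2

theorem measurable_cost (hmono : MonotoneOn ϑ (Ici 0)) :
    Measurable fun p : EuclideanSpace ℝ (Fin d) × EuclideanSpace ℝ (Fin d) =>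
      ENNReal.ofReal (ϑ ‖p.1 - p.2‖) :=
  (hmono.measurable_comp_nonneg (by fun_prop) fun _ => norm_nonneg _).ennreal_ofReal

theorem lowerSemicontinuous_transportCost (hnonneg : ∀ t ∈ Ici (0 : ℝ), 0 ≤ ϑ t)
    (hmono : MonotoneOn ϑ (Ici 0)) (hconc : ConcaveOn ℝ (Ici 0) ϑ) :
    LowerSemicontinuous fun q : FiniteMeasure
      (EuclideanSpace ℝ (Fin d) × EuclideanSpace ℝ (Fin d)) =>
        transportCost ϑ (q : Measure (EuclideanSpace ℝ (Fin d) × EuclideanSpace ℝ (Fin d))) := by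
  let E := EuclideanSpace ℝ (Fin d)
  have hcont : ∀ n, Continuous fun p : E × E => (truncatedCost ϑ n ‖p.1 - p.2‖).toNNReal :=
    fun n => continuous_real_toNNReal.comp
      ((continuousOn_truncatedCost hmono hconc n).comp_continuous (by fun_prop)
        fun p => norm_nonneg _)
  let f : ℕ → BoundedContinuousFunction (E × E) ℝ≥0 := fun n =>
    BoundedContinuousFunction.mkOfBound ⟨_, hcont n⟩ (ϑ 0 + n) (by
      intro p p'
      have hb : ∀ p : E × E, ((truncatedCost ϑ n ‖p.1 - p.2‖).toNNReal : ℝ) ∈ Icc 0 (ϑ 0 + n) :=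
        fun p => ⟨NNReal.coe_nonneg _, by
          rw [Real.coe_toNNReal _ (truncatedCost_nonneg hnonneg hmono n (norm_nonneg _))]
          exact truncatedCost_le hmono n (norm_nonneg _)⟩
      have := Real.dist_le_of_mem_Icc (hb p) (hb p')
      rwa [sub_zero] at this)
  have hf : ∀ p, Monotone fun n => f n p := fun p n k hnk =>
    Real.toNNReal_le_toNNReal (truncatedCost_mono hmono (norm_nonneg _) hnk)
  have hsup : ∀ p : E × E, ⨆ n, (f n p : ℝ≥0∞) = ENNReal.ofReal (ϑ ‖p.1 - p.2‖) := by
    intro p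
    refine le_antisymm (iSup_le fun n => ?_) ?_
    · exact ENNReal.ofReal_le_ofReal (truncatedCost_le_self hmono n (norm_nonneg _))
    · obtain ⟨n, hn⟩ := exists_truncatedCost_eq (ϑ := ϑ) (norm_nonneg (p.1 - p.2))
      refine le_iSup_of_le n ?_
      rw [← hn]
      exact le_rfl
  have := lowerSemicontinuous_lintegral_iSup hf
  simp_rw [hsup] at this
  exact this

/-! ### Compactness of the semicouplings and existence of an optimizer. -/

theorem isFiniteMeasure_of_mem_semicouplings {μ ν : Measure (EuclideanSpace ℝ (Fin d))}
    [IsFiniteMeasure ν] {q : Measure (EuclideanSpace ℝ (Fin d) × EuclideanSpace ℝ (Fin d))}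
    (hq : q ∈ semicouplings μ ν) : IsFiniteMeasure q := by
  refine ⟨?_⟩
  have : q univ = ν univ := by
    rw [← hq.2, Measure.map_apply measurable_snd MeasurableSet.univ, preimage_univ]
  rw [this]
  exact measure_lt_top ν univ

theorem tendsto_measure_compl_closedBall {E : Type*} [PseudoMetricSpace E] [MeasurableSpace E]
    [OpensMeasurableSpace E] (μ : Measure E) [IsFiniteMeasure μ] (x : E) :
    Tendsto (fun n : ℕ => μ (Metric.closedBall x n)ᶜ) atTop (𝓝 0) := by
  have h := tendsto_measure_iInter_atTop (μ := μ) (s := fun n : ℕ => (Metric.closedBall x n)ᶜ)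
    (fun n => Metric.isClosed_closedBall.measurableSet.compl.nullMeasurableSet)
    (fun n k hnk => compl_subset_compl.2 (Metric.closedBall_subset_closedBall (Nat.cast_le.2 hnk)))
    ⟨0, measure_ne_top _ _⟩
  rwa [← compl_iUnion, Metric.iUnion_closedBall_nat, compl_univ, measure_empty] at h

/-- Prokhorov's theorem applies because the mass outside `B n ×ˢ B n` is at most `μ (B n)ᶜ + ν (B
n)ᶜ`, uniformly in `q`. Both marginal constraints are closed since pushforward along a projection is
weakly continuous. -/
theorem isCompact_semicouplings (μ ν : Measure (EuclideanSpace ℝ (Fin d)))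
    [IsFiniteMeasure μ] [IsFiniteMeasure ν] :
    IsCompact {q : FiniteMeasure (EuclideanSpace ℝ (Fin d) × EuclideanSpace ℝ (Fin d)) |
      (q : Measure (EuclideanSpace ℝ (Fin d) × EuclideanSpace ℝ (Fin d))) ∈
        semicouplings μ ν} := by
  let E := EuclideanSpace ℝ (Fin d)
  let B : ℕ → Set E := fun n => Metric.closedBall 0 n
  let u : ℕ → ℝ≥0 := fun n => (μ (B n)ᶜ + ν (B n)ᶜ).toNNReal
  have hu : Tendsto u atTop (𝓝 0) := by
    have h := (tendsto_measure_compl_closedBall μ (0 : E)).add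
      (tendsto_measure_compl_closedBall ν (0 : E))
    rw [add_zero] at h
    exact (ENNReal.tendsto_toNNReal ENNReal.zero_ne_top).comp h
  have hK : ∀ n, IsCompact (B n ×ˢ B n) := fun n =>
    (isCompact_closedBall _ _).prod (isCompact_closedBall _ _)
  refine (isCompact_setOfPred_finiteMeasure_mass_le_compl_isCompact_le (ν univ).toNNReal hu hK
    (Or.inl inferInstance)).of_isClosed_subset ?_ ?_
  · have h1 : IsClosed
        {q : FiniteMeasure (E × E) | ((q.map Prod.fst : FiniteMeasure E) : Measure E) ≤ μ} :=
      (isClosed_setOf_finiteMeasure_le μ).preimage (FiniteMeasure.continuous_map continuous_fst)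
    have h2 : IsClosed
        {q : FiniteMeasure (E × E) | q.map Prod.snd = (⟨ν, inferInstance⟩ : FiniteMeasure E)} :=
      isClosed_eq (FiniteMeasure.continuous_map continuous_snd) continuous_const
    convert h1.inter h2 using 1
    ext q
    simp only [semicouplings, mem_ofPred_eq, mem_inter_iff, FiniteMeasure.toMeasure_map]
    refine and_congr_right fun _ => ?_
    exact ⟨fun h => Subtype.ext h, fun h => congrArg Subtype.val h⟩
  · intro q hq
    refine ⟨?_, fun n => ?_⟩
    · have : (q : Measure (E × E)) univ = ν univ := by
        rw [← hq.2, Measure.map_apply measurable_snd MeasurableSet.univ, preimage_univ]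
      exact (congrArg ENNReal.toNNReal this).le
    · rw [FiniteMeasure.coeFn_def]
      refine ENNReal.toNNReal_mono (ENNReal.add_ne_top.2 ⟨measure_ne_top _ _, measure_ne_top _ _⟩) ?_
      have hB : MeasurableSet (B n)ᶜ := Metric.isClosed_closedBall.measurableSet.compl
      calc (q : Measure (E × E)) (B n ×ˢ B n)ᶜ
          ≤ (q : Measure (E × E)) (Prod.fst ⁻¹' (B n)ᶜ ∪ Prod.snd ⁻¹' (B n)ᶜ) := by
            refine measure_mono fun p hp => ?_
            by_contra h
            simp only [mem_union, mem_preimage, mem_compl_iff, not_or, not_not] at h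
            exact hp h
        _ ≤ _ := measure_union_le _ _
        _ ≤ μ (B n)ᶜ + ν (B n)ᶜ := by
            rw [← Measure.map_apply measurable_fst hB, ← Measure.map_apply measurable_snd hB, hq.2]
            gcongr
            exact hq.1

theorem optimalCost_le {μ ν : Measure (EuclideanSpace ℝ (Fin d))}
    {q : Measure (EuclideanSpace ℝ (Fin d) × EuclideanSpace ℝ (Fin d))}
    (hq : q ∈ semicouplings μ ν) : optimalCost ϑ μ ν ≤ transportCost ϑ q :=
  iInf₂_le q hq

theorem exists_isOptimizer {μ ν : Measure (EuclideanSpace ℝ (Fin d))}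
    [IsFiniteMeasure μ] [IsFiniteMeasure ν] (hnonneg : ∀ t ∈ Ici (0 : ℝ), 0 ≤ ϑ t)
    (hmono : MonotoneOn ϑ (Ici 0)) (hconc : ConcaveOn ℝ (Ici 0) ϑ)
    (hfin : optimalCost ϑ μ ν < ∞) : ∃ q, IsOptimizer ϑ μ ν q := by
  -- An infimum over the empty set would be `∞`.
  have hne : (semicouplings μ ν).Nonempty := by
    by_contra h
    rw [not_nonempty_iff_eq_empty] at h
    simp [optimalCost, h] at hfin
  obtain ⟨q₀, hq₀⟩ := hne
  obtain ⟨q, hq, hmin⟩ := LowerSemicontinuousOn.exists_isMinOn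
    ⟨⟨q₀, isFiniteMeasure_of_mem_semicouplings hq₀⟩, hq₀⟩ (isCompact_semicouplings μ ν)
    ((lowerSemicontinuous_transportCost hnonneg hmono hconc).lowerSemicontinuousOn _)
  refine ⟨q, hq, le_antisymm (le_iInf₂ fun q' hq' => ?_) (optimalCost_le hq)⟩
  exact hmin (a := ⟨q', isFiniteMeasure_of_mem_semicouplings hq'⟩) hq'

end Cost

/-! ### Optimality tested by exchanging small amounts of mass. -/

section Exchange

variable {d : ℕ} {ϑ : ℝ → ℝ} {μ ν : Measure (EuclideanSpace ℝ (Fin d))}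
  {q : Measure (EuclideanSpace ℝ (Fin d) × EuclideanSpace ℝ (Fin d))}

theorem transportCost_add (a b : Measure (EuclideanSpace ℝ (Fin d) × EuclideanSpace ℝ (Fin d))) :
    transportCost ϑ (a + b) = transportCost ϑ a + transportCost ϑ b :=
  lintegral_add_measure _ _ _

theorem transportCost_smul (c : ℝ≥0∞)
    (a : Measure (EuclideanSpace ℝ (Fin d) × EuclideanSpace ℝ (Fin d))) :
    transportCost ϑ (c • a) = c * transportCost ϑ a :=
  lintegral_smul_measure _ _

/-- Replacing a part of an optimizer does not decrease the cost, when the targets are kept and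
only sources that are available are added. -/
theorem IsOptimizer.transportCost_le_of_exchange (hq : IsOptimizer ϑ μ ν q)
    (hfin : optimalCost ϑ μ ν < ∞) {ξ : Measure (EuclideanSpace ℝ (Fin d))}
    (hξ : q.map Prod.fst + ξ ≤ μ)
    {r a a' : Measure (EuclideanSpace ℝ (Fin d) × EuclideanSpace ℝ (Fin d))} (hra : r + a = q)
    (hfst : a'.map Prod.fst ≤ a.map Prod.fst + ξ) (hsnd : a'.map Prod.snd = a.map Prod.snd) :
    transportCost ϑ a ≤ transportCost ϑ a' := by
  have ha' : r + a' ∈ semicouplings μ ν := by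
    refine ⟨?_, ?_⟩
    · refine le_trans ?_ hξ
      rw [← hra, Measure.map_add _ _ measurable_fst, Measure.map_add _ _ measurable_fst, add_assoc]
      gcongr
    · rw [Measure.map_add _ _ measurable_snd, hsnd, ← Measure.map_add _ _ measurable_snd, hra]
      exact hq.1.2
  have h1 := hq.2
  have h2 := optimalCost_le (ϑ := ϑ) ha'
  rw [← h1, ← hra, transportCost_add, transportCost_add] at h2
  refine (ENNReal.add_le_add_iff_left ?_).1 h2
  refine ne_top_of_le_ne_top hfin.ne ?_
  rw [← h1, ← hra, transportCost_add]
  exact le_self_add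

theorem IsOptimizer.convex_combination {q₁ q₂ : Measure _} (h₁ : IsOptimizer ϑ μ ν q₁)
    (h₂ : IsOptimizer ϑ μ ν q₂) {s t : ℝ≥0∞} (hst : s + t = 1) :
    IsOptimizer ϑ μ ν (s • q₁ + t • q₂) := by
  refine ⟨⟨?_, ?_⟩, ?_⟩
  · rw [Measure.map_add _ _ measurable_fst, Measure.map_smul, Measure.map_smul]
    calc s • q₁.map Prod.fst + t • q₂.map Prod.fst ≤ s • μ + t • μ := by
          gcongr
          exacts [h₁.1.1, h₂.1.1]
      _ = μ := by rw [← add_smul, hst, one_smul]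
  · rw [Measure.map_add _ _ measurable_snd, Measure.map_smul, Measure.map_smul, h₁.1.2, h₂.1.2,
      ← add_smul, hst, one_smul]
  · rw [transportCost_add, transportCost_smul, transportCost_smul, h₁.2, h₂.2, ← add_mul, hst,
      one_mul]

/-- If the pairs violating the bound had positive mass, a fraction of them could be served instead
from unused mass in the `ε`-ball around `z`, at strictly smaller cost. -/
theorem IsOptimizer.ae_norm_sub_le_of_mem_support [IsFiniteMeasure ν]
    (hnonneg : ∀ t ∈ Ici (0 : ℝ), 0 ≤ ϑ t)
    (hmono : StrictMonoOn ϑ (Ici 0)) (hq : IsOptimizer ϑ μ ν q) (hfin : optimalCost ϑ μ ν < ∞)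
    {ξ : Measure (EuclideanSpace ℝ (Fin d))} [IsFiniteMeasure ξ] (hξ : q.map Prod.fst + ξ ≤ μ)
    {z : EuclideanSpace ℝ (Fin d)} (hz : z ∈ ξ.support) {ε : ℝ} (hε : 0 < ε) :
    ∀ᵐ p ∂q, ‖p.1 - p.2‖ ≤ ‖z - p.2‖ + ε := by
  have := isFiniteMeasure_of_mem_semicouplings hq.1
  let A : Set (EuclideanSpace ℝ (Fin d) × EuclideanSpace ℝ (Fin d)) :=
    {p | ‖z - p.2‖ + ε < ‖p.1 - p.2‖}
  have hA : MeasurableSet A := measurableSet_lt (by fun_prop) (by fun_prop)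
  suffices q A = 0 by simpa [ae_iff, A] using this
  by_contra hqA
  let W := Metric.ball z ε
  have hW : ξ W ≠ 0 := ((Measure.mem_support_iff_forall _).1 hz W (Metric.ball_mem_nhds z hε)).ne'
  have hW' : ξ W ≠ ∞ := measure_ne_top _ _
  -- The fraction `t` of the bad mass is small enough for the unused mass in `W` to replace it.
  obtain ⟨t, ht0, ht1, htA⟩ : ∃ t : ℝ≥0∞, t ≠ 0 ∧ t ≤ 1 ∧ t * q A ≤ ξ W := by
    refine ⟨min 1 (ξ W / q A), ?_, min_le_left _ _, ?_⟩
    · exact (lt_min one_pos (ENNReal.div_pos hW (measure_ne_top _ _))).ne'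
    · exact (mul_le_mul_left (min_le_right _ _) _).trans
        (ENNReal.div_mul_cancel hqA (measure_ne_top _ _)).le
  have htop : t ≠ ∞ := ne_top_of_le_ne_top ENNReal.one_ne_top ht1
  -- This bound on the new cost depends on the target alone, so it integrates explicitly against a
  -- product measure. On `A` it lies strictly below the old cost.
  let k : EuclideanSpace ℝ (Fin d) → ℝ≥0∞ := fun y => ENNReal.ofReal (ϑ (‖z - y‖ + ε))
  have hk : Measurable k :=
    (hmono.monotoneOn.measurable_comp_nonneg (by fun_prop) fun y => by positivity).ennreal_ofReal
  let m := (q.restrict A).map Prod.snd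
  -- The factor `t / ξ W` makes the second marginal of the new part exactly `t • m`; its first
  -- marginal is then `(t * q A / ξ W) • ξ.restrict W`, which is at most `ξ`.
  have hle := hq.transportCost_le_of_exchange hfin hξ
    (r := q.restrict Aᶜ + (1 - t) • q.restrict A) (a := t • q.restrict A)
    (a' := (t / ξ W) • (ξ.restrict W).prod m) ?_ ?_ ?_
  · have hlt : ∫⁻ p in A, k p.2 ∂q < ∫⁻ p in A, ENNReal.ofReal (ϑ ‖p.1 - p.2‖) ∂q := by
      refine setLIntegral_strict_mono hA hqA (measurable_cost hmono.monotoneOn) ?_ ?_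
      · refine ne_top_of_le_ne_top (hq.2 ▸ hfin.ne) ?_
        refine (setLIntegral_mono' hA fun p hp => ?_).trans (setLIntegral_le_lintegral A _)
        exact ENNReal.ofReal_le_ofReal
          (hmono.monotoneOn (mem_Ici.2 (by positivity)) (mem_Ici.2 (norm_nonneg _)) (le_of_lt hp))
      · refine Eventually.of_forall fun p hp => ?_
        have h0 : (0 : ℝ) ≤ ‖z - p.2‖ + ε := by positivity
        exact (ENNReal.ofReal_lt_ofReal_iff_of_nonneg (hnonneg _ h0)).2
          (hmono (mem_Ici.2 h0) (mem_Ici.2 (norm_nonneg _)) hp)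
    have hcost : transportCost ϑ ((ξ.restrict W).prod m) ≤ ξ W * ∫⁻ p in A, k p.2 ∂q := by
      calc transportCost ϑ ((ξ.restrict W).prod m)
          ≤ ∫⁻ p, k p.2 ∂((ξ.restrict W).prod m) := by
            have hae : ∀ᵐ p ∂((ξ.restrict W).prod m), p.1 ∈ W :=
              Measure.quasiMeasurePreserving_fst.ae
                (ae_restrict_mem Metric.isOpen_ball.measurableSet)
            refine lintegral_mono_ae ?_
            filter_upwards [hae] with p hp
            refine ENNReal.ofReal_le_ofReal (hmono.monotoneOn (mem_Ici.2 (norm_nonneg _))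
              (mem_Ici.2 (by positivity)) ?_)
            have h1 : ‖p.1 - z‖ < ε := mem_ball_iff_norm.1 hp
            have h2 := norm_sub_le_norm_sub_add_norm_sub p.1 z p.2
            linarith
        _ = ∫⁻ y, k y ∂(((ξ.restrict W).prod m).map Prod.snd) := (lintegral_map hk measurable_snd).symm
        _ = ξ W * ∫⁻ p in A, k p.2 ∂q := by
            rw [Measure.map_snd_prod, lintegral_smul_measure, Measure.restrict_apply_univ,
              smul_eq_mul, lintegral_map hk measurable_snd]
    rw [transportCost_smul, transportCost_smul] at hle
    refine hle.not_gt ?_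
    calc t / ξ W * transportCost ϑ ((ξ.restrict W).prod m)
        ≤ t / ξ W * (ξ W * ∫⁻ p in A, k p.2 ∂q) := by gcongr
      _ = t * ∫⁻ p in A, k p.2 ∂q := by rw [← mul_assoc, ENNReal.div_mul_cancel hW hW']
      _ < t * transportCost ϑ (q.restrict A) := ENNReal.mul_lt_mul_right ht0 htop hlt
  · rw [add_assoc, ← add_smul, tsub_add_cancel_of_le ht1, one_smul, add_comm,
      Measure.restrict_add_restrict_compl hA]
  · refine le_trans ?_ (Measure.le_add_left le_rfl)
    rw [Measure.map_smul, Measure.map_fst_prod, Measure.map_apply measurable_snd MeasurableSet.univ,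
      preimage_univ, Measure.restrict_apply_univ, smul_smul]
    refine le_trans ?_ (Measure.restrict_le_self (s := W))
    have hc : t / ξ W * q A ≤ 1 := by
      rw [← ENNReal.mul_div_right_comm]
      exact ENNReal.div_le_of_le_mul (by rwa [one_mul])
    calc (t / ξ W * q A) • ξ.restrict W ≤ (1 : ℝ≥0∞) • ξ.restrict W := by gcongr
      _ = ξ.restrict W := one_smul _ _
  · rw [Measure.map_smul, Measure.map_snd_prod, Measure.restrict_apply_univ, smul_smul,
      ENNReal.div_mul_cancel hW hW', Measure.map_smul]

/-- A countable dense subset of the support and `ε = 1 / (n + 1)` leave countably many null sets;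
the remaining `z` follow because the inequality is closed in `z`. -/
theorem IsOptimizer.ae_forall_norm_sub_le [IsFiniteMeasure ν]
    (hnonneg : ∀ t ∈ Ici (0 : ℝ), 0 ≤ ϑ t)
    (hmono : StrictMonoOn ϑ (Ici 0)) (hq : IsOptimizer ϑ μ ν q) (hfin : optimalCost ϑ μ ν < ∞)
    {ξ : Measure (EuclideanSpace ℝ (Fin d))} [IsFiniteMeasure ξ] (hξ : q.map Prod.fst + ξ ≤ μ) :
    ∀ᵐ p ∂q, ∀ z ∈ ξ.support, ‖p.1 - p.2‖ ≤ ‖z - p.2‖ := by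
  obtain ⟨D, hDs, hDc, hD⟩ :=
    (TopologicalSpace.IsSeparable.of_separableSpace ξ.support).exists_countable_dense_subset
  have h1 : ∀ᵐ p ∂q, ∀ z ∈ D, ∀ n : ℕ, ‖p.1 - p.2‖ ≤ ‖z - p.2‖ + 1 / ((n : ℝ) + 1) :=
    (ae_ball_iff hDc).2 fun z hz => ae_all_iff.2 fun n =>
      hq.ae_norm_sub_le_of_mem_support hnonneg hmono hfin hξ (hDs hz) (by positivity)
  filter_upwards [h1] with p hp z hz
  have hclosed : IsClosed {z : EuclideanSpace ℝ (Fin d) | ‖p.1 - p.2‖ ≤ ‖z - p.2‖} :=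
    isClosed_le continuous_const (by fun_prop)
  refine closure_minimal (fun w hw => ?_) hclosed (hD hz)
  refine mem_ofPred_eq.mpr (le_of_forall_pos_le_add fun ε hε => ?_)
  obtain ⟨n, hn⟩ := exists_nat_one_div_lt hε
  exact (hp w hw n).trans (by gcongr)

theorem ConcaveOn.continuousAt_norm_sub (hconc : ConcaveOn ℝ (Ici 0) ϑ)
    {p : EuclideanSpace ℝ (Fin d) × EuclideanSpace ℝ (Fin d)} (hp : p.1 ≠ p.2) :
    ContinuousAt (fun p : EuclideanSpace ℝ (Fin d) × EuclideanSpace ℝ (Fin d) =>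
      ϑ ‖p.1 - p.2‖) p := by
  have h := hconc.continuousOn_interior
  rw [interior_Ici] at h
  exact ContinuousAt.comp (f := fun p : EuclideanSpace ℝ (Fin d) × EuclideanSpace ℝ (Fin d) =>
    ‖p.1 - p.2‖) (h.continuousAt (Ioi_mem_nhds (norm_pos_iff.2 (sub_ne_zero.2 hp)))) (by fun_prop)

theorem exists_isOpen_prod_of_eventually {X Y : Type*} [TopologicalSpace X] [TopologicalSpace Y]
    {x : X} {y : Y} {P : X × Y → Prop} (h : ∀ᶠ p in 𝓝 (x, y), P p) :
    ∃ U V, IsOpen U ∧ x ∈ U ∧ IsOpen V ∧ y ∈ V ∧ ∀ u ∈ U, ∀ v ∈ V, P (u, v) := by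
  obtain ⟨U, V, hU, hx, hV, hy, h⟩ := mem_nhds_prod_iff'.1 h
  exact ⟨U, V, hU, hx, hV, hy, fun u hu v hv => h (mk_mem_prod hu hv)⟩

/-- If swapping the targets were cheaper, continuity of the cost at the four off-diagonal pairs
would make it cheaper for small amounts of mass near both points. Recombining the marginals of this
mass crosswise keeps both marginals of `q` and lowers the cost. -/
theorem IsOptimizer.monotone_of_mem_support [IsFiniteMeasure ν]
    (hnonneg : ∀ t ∈ Ici (0 : ℝ), 0 ≤ ϑ t) (hconc : ConcaveOn ℝ (Ici 0) ϑ)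
    (hq : IsOptimizer ϑ μ ν q) (hfin : optimalCost ϑ μ ν < ∞)
    {x y x' y' : EuclideanSpace ℝ (Fin d)} (hp : (x, y) ∈ q.support) (hp' : (x', y') ∈ q.support)
    (hxy : x ≠ y) (hxy' : x' ≠ y') (hne : x ≠ y') (hne' : x' ≠ y) :
    ϑ ‖x - y‖ + ϑ ‖x' - y'‖ ≤ ϑ ‖x - y'‖ + ϑ ‖x' - y‖ := by
  have := isFiniteMeasure_of_mem_semicouplings hq.1
  by_contra! hgap
  obtain ⟨η, hη, hη'⟩ : ∃ η > 0,
      ϑ ‖x - y'‖ + η + (ϑ ‖x' - y‖ + η) < ϑ ‖x - y‖ - η + (ϑ ‖x' - y'‖ - η) :=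
    ⟨(ϑ ‖x - y‖ + ϑ ‖x' - y'‖ - (ϑ ‖x - y'‖ + ϑ ‖x' - y‖)) / 8, by linarith, by linarith⟩
  obtain ⟨X₁, Y₁, hX₁, hxX₁, hY₁, hyY₁, h₁⟩ := exists_isOpen_prod_of_eventually
    ((hconc.continuousAt_norm_sub (p := (x, y)) hxy).eventually_const_lt
      (sub_lt_self (ϑ ‖x - y‖) hη))
  obtain ⟨X₂, Y₂, hX₂, hxX₂, hY₂, hyY₂, h₂⟩ := exists_isOpen_prod_of_eventually
    ((hconc.continuousAt_norm_sub (p := (x', y')) hxy').eventually_const_lt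
      (sub_lt_self (ϑ ‖x' - y'‖) hη))
  obtain ⟨X₃, Y₃, hX₃, hxX₃, hY₃, hyY₃, h₃⟩ := exists_isOpen_prod_of_eventually
    ((hconc.continuousAt_norm_sub (p := (x, y')) hne).eventually_lt_const
      (lt_add_of_pos_right (ϑ ‖x - y'‖) hη))
  obtain ⟨X₄, Y₄, hX₄, hxX₄, hY₄, hyY₄, h₄⟩ := exists_isOpen_prod_of_eventually
    ((hconc.continuousAt_norm_sub (p := (x', y)) hne').eventually_lt_const
      (lt_add_of_pos_right (ϑ ‖x' - y‖) hη))
  have hX := hX₁.inter hX₃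
  have hX' := hX₂.inter hX₄
  have hY := hY₁.inter hY₄
  have hY' := hY₂.inter hY₃
  let a := ((X₁ ∩ X₃) ×ˢ (Y₁ ∩ Y₄))
  let b := ((X₂ ∩ X₄) ×ˢ (Y₂ ∩ Y₃))
  have ha : IsOpen a := hX.prod hY
  have hb : IsOpen b := hX'.prod hY'
  have ha0 : q a ≠ 0 := ((Measure.mem_support_iff_forall _).1 hp a
    (ha.mem_nhds ⟨⟨hxX₁, hxX₃⟩, hyY₁, hyY₄⟩)).ne'
  have hb0 : q b ≠ 0 := ((Measure.mem_support_iff_forall _).1 hp' b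
    (hb.mem_nhds ⟨⟨hxX₂, hxX₄⟩, hyY₂, hyY₃⟩)).ne'
  have := ProbabilityTheory.cond_isProbabilityMeasure ha0
  have := ProbabilityTheory.cond_isProbabilityMeasure hb0
  have hae := ProbabilityTheory.ae_cond_mem (μ := q) ha.measurableSet
  have hbe := ProbabilityTheory.ae_cond_mem (μ := q) hb.measurableSet
  set α := ProbabilityTheory.cond q a with hα
  set β := ProbabilityTheory.cond q b with hβ
  -- The halves ensure `t • α + t • β ≤ q` even when `a` and `b` overlap.
  obtain ⟨t, ht0, hta, htb⟩ : ∃ t : ℝ≥0∞, t ≠ 0 ∧ t ≤ q a / 2 ∧ t ≤ q b / 2 :=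
    ⟨min (q a / 2) (q b / 2), (lt_min (ENNReal.half_pos ha0) (ENNReal.half_pos hb0)).ne',
      min_le_left _ _, min_le_right _ _⟩
  have htop : t ≠ ∞ := ne_top_of_le_ne_top (ENNReal.div_ne_top (measure_ne_top q a) two_ne_zero) hta
  have hhalf : ∀ s, q s ≠ 0 → t ≤ q s / 2 →
      t • ProbabilityTheory.cond q s ≤ (2⁻¹ : ℝ≥0∞) • q := by
    intro s hs hts
    rw [ProbabilityTheory.cond, smul_smul]
    have hc : t * (q s)⁻¹ ≤ 2⁻¹ := by
      rw [← div_eq_mul_inv]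
      refine ENNReal.div_le_of_le_mul ?_
      rwa [mul_comm, ← div_eq_mul_inv]
    calc (t * (q s)⁻¹) • q.restrict s ≤ (2⁻¹ : ℝ≥0∞) • q.restrict s := by gcongr
      _ ≤ (2⁻¹ : ℝ≥0∞) • q := by
        gcongr
        exact Measure.restrict_le_self
  have hle : t • (α + β) ≤ q := by
    calc t • (α + β) = t • α + t • β := smul_add _ _ _
      _ ≤ (2⁻¹ : ℝ≥0∞) • q + (2⁻¹ : ℝ≥0∞) • q := add_le_add (hhalf a ha0 hta) (hhalf b hb0 htb)
      _ = q := by rw [← add_smul, ENNReal.inv_two_add_inv_two, one_smul]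
  have : IsFiniteMeasure (t • (α + β)) := isFiniteMeasure_of_le q hle
  have hmap : ∀ (m : Measure (EuclideanSpace ℝ (Fin d) × EuclideanSpace ℝ (Fin d)))
      [IsProbabilityMeasure m], IsProbabilityMeasure (m.map Prod.fst) ∧
        IsProbabilityMeasure (m.map Prod.snd) := fun m _ =>
    ⟨Measure.isProbabilityMeasure_map (by fun_prop), Measure.isProbabilityMeasure_map (by fun_prop)⟩
  obtain ⟨_, _⟩ := hmap α
  obtain ⟨_, _⟩ := hmap β
  have hex := hq.transportCost_le_of_exchange hfin (ξ := 0) (by rw [add_zero]; exact hq.1.1)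
    (a' := t • ((α.map Prod.fst).prod (β.map Prod.snd) + (β.map Prod.fst).prod (α.map Prod.snd)))
    (Measure.sub_add_cancel_of_le hle) ?_ ?_
  · rw [transportCost_smul, transportCost_smul, ENNReal.mul_le_mul_iff_right ht0 htop,
      transportCost_add, transportCost_add] at hex
    have lower : ∀ (m : Measure (EuclideanSpace ℝ (Fin d) × EuclideanSpace ℝ (Fin d)))
        [IsProbabilityMeasure m] (c : ℝ), (∀ᵐ p ∂m, c < ϑ ‖p.1 - p.2‖) →
        ENNReal.ofReal c ≤ transportCost ϑ m := by
      intro m _ c h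
      calc ENNReal.ofReal c = ∫⁻ _, ENNReal.ofReal c ∂m := by simp
        _ ≤ _ := lintegral_mono_ae (h.mono fun p hp => ENNReal.ofReal_le_ofReal hp.le)
    have upper : ∀ (m : Measure (EuclideanSpace ℝ (Fin d) × EuclideanSpace ℝ (Fin d)))
        [IsProbabilityMeasure m] (c : ℝ), (∀ᵐ p ∂m, ϑ ‖p.1 - p.2‖ < c) →
        transportCost ϑ m ≤ ENNReal.ofReal c := by
      intro m _ c h
      calc transportCost ϑ m ≤ ∫⁻ _, ENNReal.ofReal c ∂m :=
            lintegral_mono_ae (h.mono fun p hp => ENNReal.ofReal_le_ofReal hp.le)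
        _ = ENNReal.ofReal c := by simp
    have hfst : ∀ (m : Measure (EuclideanSpace ℝ (Fin d) × EuclideanSpace ℝ (Fin d))) (X Y : Set _),
        IsOpen X → (∀ᵐ p ∂m, p ∈ X ×ˢ Y) → ∀ᵐ x ∂(m.map Prod.fst), x ∈ X := fun m X Y hX h =>
      (ae_map_iff measurable_fst.aemeasurable hX.measurableSet).2 (h.mono fun p hp => hp.1)
    have hsnd : ∀ (m : Measure (EuclideanSpace ℝ (Fin d) × EuclideanSpace ℝ (Fin d))) (X Y : Set _),
        IsOpen Y → (∀ᵐ p ∂m, p ∈ X ×ˢ Y) → ∀ᵐ x ∂(m.map Prod.snd), x ∈ Y := fun m X Y hY h =>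
      (ae_map_iff measurable_snd.aemeasurable hY.measurableSet).2 (h.mono fun p hp => hp.2)
    have l1 := lower α _ (hae.mono fun p hp => h₁ p.1 hp.1.1 p.2 hp.2.1)
    have l2 := lower β _ (hbe.mono fun p hp => h₂ p.1 hp.1.1 p.2 hp.2.1)
    have u1 := upper ((α.map Prod.fst).prod (β.map Prod.snd)) _ (by
      filter_upwards [Measure.quasiMeasurePreserving_fst.ae (hfst α _ _ hX hae),
        Measure.quasiMeasurePreserving_snd.ae (hsnd β _ _ hY' hbe)] with p hp1 hp2
      exact h₃ p.1 hp1.2 p.2 hp2.2)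
    have u2 := upper ((β.map Prod.fst).prod (α.map Prod.snd)) _ (by
      filter_upwards [Measure.quasiMeasurePreserving_fst.ae (hfst β _ _ hX' hbe),
        Measure.quasiMeasurePreserving_snd.ae (hsnd α _ _ hY hae)] with p hp1 hp2
      exact h₄ p.1 hp1.2 p.2 hp2.2)
    have hn3 := hnonneg _ (norm_nonneg (x - y'))
    have hn4 := hnonneg _ (norm_nonneg (x' - y))
    have hchain := (ENNReal.ofReal_add_le.trans (add_le_add l1 l2)).trans
      (hex.trans (add_le_add u1 u2))
    rw [← ENNReal.ofReal_add (by linarith) (by linarith),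
      ENNReal.ofReal_le_ofReal_iff (by linarith)] at hchain
    exact hη'.not_ge hchain
  · simp only [Measure.map_smul, Measure.map_add _ _ measurable_fst, Measure.map_fst_prod,
      measure_univ, one_smul, add_zero, le_refl]
  · simp only [Measure.map_smul, Measure.map_add _ _ measurable_snd, Measure.map_snd_prod,
      measure_univ, one_smul]
    rw [add_comm]

end Exchange

/-! ### First marginals, transport maps and uniqueness. -/

section Structure

open scoped ProbabilityTheory

variable {d : ℕ} {ϑ : ℝ → ℝ} {μ ν : Measure (EuclideanSpace ℝ (Fin d))}
  {q : Measure (EuclideanSpace ℝ (Fin d) × EuclideanSpace ℝ (Fin d))}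

/-- Mutual singularity places sources and targets almost surely in complementary sets. -/
theorem ae_fst_ne_snd_of_mem_semicouplings (hsing : μ ⟂ₘ ν) (hq : q ∈ semicouplings μ ν) :
    ∀ᵐ p ∂q, p.1 ≠ p.2 := by
  obtain ⟨N, -, hμ, hν⟩ := hsing
  have h1 : ∀ᵐ p ∂q, p.1 ∉ N :=
    ae_of_ae_map measurable_fst.aemeasurable
      (measure_eq_zero_iff_ae_notMem.1 (le_antisymm ((hq.1 N).trans hμ.le) zero_le))
  have h2 : ∀ᵐ p ∂q, p.2 ∉ Nᶜ :=
    ae_of_ae_map measurable_snd.aemeasurable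
      (measure_eq_zero_iff_ae_notMem.1 (hq.2 ▸ hν))
  filter_upwards [h1, h2] with p hp1 hp2 h
  exact hp2 (h ▸ hp1)

theorem DoesNotChargeSmallSets.ae_fst_notMem (hsmall : DoesNotChargeSmallSets μ)
    (hq : q ∈ semicouplings μ ν) {S : Set (EuclideanSpace ℝ (Fin d))}
    (hS : IsRectifiableSet (d - 1) S) : ∀ᵐ x ∂(q.map Prod.fst), x ∉ S :=
  measure_eq_zero_iff_ae_notMem.1 (le_antisymm ((hq.1 S).trans (hsmall S hS).le) zero_le)

/-- An optimizer uses all of the mass of `μ` outside the support of the unused part of `μ`, and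
none of the mass on it. -/
theorem IsOptimizer.map_fst_eq_restrict [IsFiniteMeasure μ] [IsFiniteMeasure ν] (hsing : μ ⟂ₘ ν)
    (hsmall : DoesNotChargeSmallSets μ) (hnonneg : ∀ t ∈ Ici (0 : ℝ), 0 ≤ ϑ t)
    (hmono : StrictMonoOn ϑ (Ici 0)) (hq : IsOptimizer ϑ μ ν q) (hfin : optimalCost ϑ μ ν < ∞) :
    ∃ B, MeasurableSet B ∧ q.map Prod.fst = μ.restrict B := by
  have := isFiniteMeasure_of_mem_semicouplings hq.1
  let ξ := μ - q.map Prod.fst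
  have hsum : q.map Prod.fst + ξ = μ := by
    rw [add_comm]
    exact Measure.sub_add_cancel_of_le hq.1.1
  have : IsFiniteMeasure ξ := isFiniteMeasure_of_le μ Measure.sub_le
  have hU : MeasurableSet ξ.support := Measure.isClosed_support.measurableSet
  -- A source in `ξ.support` would be a point of that set nearest to its target, and distinct from
  -- it; such points form a small set.
  have hnot : ∀ᵐ p ∂q, p.1 ∉ ξ.support := by
    filter_upwards [ae_fst_ne_snd_of_mem_semicouplings hsing hq.1,
      hq.ae_forall_norm_sub_le hnonneg hmono hfin hsum.le,
      ae_of_ae_map measurable_fst.aemeasurable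
        (hsmall.ae_fst_notMem hq.1 (isRectifiableSet_nearest_points ξ.support))] with p h1 h2 h3 h4
    exact h3 ⟨h4, p.2, h1, h2⟩
  refine ⟨ξ.supportᶜ, hU.compl, ?_⟩
  have h1 : (q.map Prod.fst).restrict ξ.supportᶜ = q.map Prod.fst :=
    Measure.restrict_eq_self_of_ae_mem
      ((ae_map_iff measurable_fst.aemeasurable hU.compl).2 hnot)
  have h2 : ξ.restrict ξ.supportᶜ = 0 :=
    Measure.restrict_eq_zero.2 Measure.measure_compl_support
  calc q.map Prod.fst = (q.map Prod.fst + ξ).restrict ξ.supportᶜ := by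
        rw [Measure.restrict_add, h1, h2, add_zero]
    _ = μ.restrict ξ.supportᶜ := by rw [hsum]

/-- On `A \ A'` the averaged density is `1/2`, while an indicator takes only the values `0` and `1`.
-/
theorem measure_diff_eq_zero_of_average_eq_restrict {X : Type*} [MeasurableSpace X]
    {m : Measure X} [IsFiniteMeasure m] {A A' C : Set X} (hA : MeasurableSet A)
    (hA' : MeasurableSet A') (hC : MeasurableSet C)
    (h : (2⁻¹ : ℝ≥0∞) • m.restrict A + (2⁻¹ : ℝ≥0∞) • m.restrict A' = m.restrict C) :
    m (A \ A') = 0 := by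
  have key : ∀ s, MeasurableSet s → 2⁻¹ * m (s ∩ A) + 2⁻¹ * m (s ∩ A') = m (s ∩ C) := by
    intro s hs
    have := congrArg (fun m => m s) h
    simpa [Measure.restrict_apply hs] using this
  have h1 := key ((A \ A') ∩ C) ((hA.diff hA').inter hC)
  have h2 := key ((A \ A') \ C) ((hA.diff hA').diff hC)
  rw [show (A \ A') ∩ C ∩ A = (A \ A') ∩ C by grind, show (A \ A') ∩ C ∩ A' = ∅ by grind,
    show (A \ A') ∩ C ∩ C = (A \ A') ∩ C by grind, measure_empty, mul_zero, add_zero] at h1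
  rw [show (A \ A') \ C ∩ A = (A \ A') \ C by grind, show (A \ A') \ C ∩ C = ∅ by grind,
    measure_empty] at h2
  have e2 : m ((A \ A') \ C) = 0 := by simpa using (add_eq_zero.1 h2).1
  have e1 : m ((A \ A') ∩ C) = 0 := by
    by_contra hne
    have := ENNReal.half_lt_self hne (measure_ne_top _ _)
    rw [ENNReal.div_eq_inv_mul, h1] at this
    exact lt_irrefl _ this
  rw [← measure_inter_add_sdiff _ hC, e1, e2, add_zero]

theorem IsOptimizer.average {q₁ q₂ : Measure _} (h₁ : IsOptimizer ϑ μ ν q₁)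
    (h₂ : IsOptimizer ϑ μ ν q₂) :
    IsOptimizer ϑ μ ν ((2⁻¹ : ℝ≥0∞) • q₁ + (2⁻¹ : ℝ≥0∞) • q₂) :=
  h₁.convex_combination h₂ ENNReal.inv_two_add_inv_two

/-- The average of the two optimizers is itself an optimizer, so its first marginal is also a
restriction of `μ`; this forces the two sets to agree up to a null set. -/
theorem IsOptimizer.map_fst_eq [IsFiniteMeasure μ] [IsFiniteMeasure ν] (hsing : μ ⟂ₘ ν)
    (hsmall : DoesNotChargeSmallSets μ) (hnonneg : ∀ t ∈ Ici (0 : ℝ), 0 ≤ ϑ t)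
    (hmono : StrictMonoOn ϑ (Ici 0)) (hfin : optimalCost ϑ μ ν < ∞) {q₁ q₂ : Measure _}
    (h₁ : IsOptimizer ϑ μ ν q₁) (h₂ : IsOptimizer ϑ μ ν q₂) :
    q₁.map Prod.fst = q₂.map Prod.fst := by
  obtain ⟨B₁, hB₁, e₁⟩ := h₁.map_fst_eq_restrict hsing hsmall hnonneg hmono hfin
  obtain ⟨B₂, hB₂, e₂⟩ := h₂.map_fst_eq_restrict hsing hsmall hnonneg hmono hfin
  obtain ⟨B, hB, e⟩ := (h₁.average h₂).map_fst_eq_restrict hsing hsmall hnonneg hmono hfin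
  rw [Measure.map_add _ _ measurable_fst, Measure.map_smul, Measure.map_smul, e₁, e₂] at e
  rw [e₁, e₂]
  exact Measure.restrict_congr_set (ae_eq_set.2
    ⟨measure_diff_eq_zero_of_average_eq_restrict hB₁ hB₂ hB e,
      measure_diff_eq_zero_of_average_eq_restrict hB₂ hB₁ hB (by rwa [add_comm])⟩)

theorem eq_dirac_of_ae_eq {X : Type*} [MeasurableSpace X] {m : Measure X} [IsProbabilityMeasure m]
    {x : X} (h : ∀ᵐ y ∂m, y = x) : m = Measure.dirac x := by
  calc m = m.map id := Measure.map_id.symm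
    _ = m.map fun _ => x := Measure.map_congr h
    _ = Measure.dirac x := by rw [Measure.map_const, measure_univ, one_smul]

/-- The off-diagonal part of the support carries `q` and is monotone, so sources with two targets
form a small set. The conditional law of the target is therefore almost surely a Dirac mass. -/
theorem IsOptimizer.exists_eq_map [IsFiniteMeasure μ] [IsFiniteMeasure ν] (hsing : μ ⟂ₘ ν)
    (hsmall : DoesNotChargeSmallSets μ) (hnonneg : ∀ t ∈ Ici (0 : ℝ), 0 ≤ ϑ t)
    (hmono : StrictMonoOn ϑ (Ici 0)) (hconc : StrictConcaveOn ℝ (Ici 0) ϑ)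
    (hq : IsOptimizer ϑ μ ν q) (hfin : optimalCost ϑ μ ν < ∞) :
    ∃ T : EuclideanSpace ℝ (Fin d) → EuclideanSpace ℝ (Fin d), Measurable T ∧
      q = (q.map Prod.fst).map fun x => (x, T x) := by
  have := isFiniteMeasure_of_mem_semicouplings hq.1
  let Γ := q.support ∩ {p | p.1 ≠ p.2}
  have hΓ : ∀ᵐ p ∂q, p ∈ Γ := by
    filter_upwards [Measure.support_mem_ae, ae_fst_ne_snd_of_mem_semicouplings hsing hq.1]
      with p h1 h2
    exact ⟨h1, h2⟩
  have hrect := isRectifiableSet_of_monotone (Γ := Γ) hmono hconc (fun p hp => hp.2)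
    fun p hp p' hp' h h' =>
      hq.monotone_of_mem_support hnonneg hconc.concaveOn hfin hp.1 hp'.1 hp.2 hp'.2 h h'
  have hsingle := hsmall.ae_fst_notMem hq.1 hrect
  let κ := q.condKernel
  have hdis : q.fst ⊗ₘ κ = q := q.disintegrate κ
  have hae : ∀ᵐ x ∂(q.map Prod.fst), ∀ᵐ y ∂(κ x), (x, y) ∈ Γ := by
    rw [← hdis] at hΓ
    exact Measure.ae_ae_of_ae_compProd hΓ
  -- The barycenter of a Dirac mass is its atom. Defining `T` this way gives a map measurable
  -- everywhere, without a selection theorem.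
  let T : EuclideanSpace ℝ (Fin d) → EuclideanSpace ℝ (Fin d) := fun x => ∫ y, y ∂(κ x)
  have hT : Measurable T :=
    (StronglyMeasurable.integral_kernel (κ := κ) stronglyMeasurable_id).measurable
  refine ⟨T, hT, ?_⟩
  have hdirac : κ =ᵐ[q.fst] ProbabilityTheory.Kernel.deterministic T hT := by
    filter_upwards [hsingle, hae] with x hx1 hx2
    obtain ⟨y₀, hy₀⟩ := hx2.exists
    have hκ : κ x = Measure.dirac y₀ := by
      refine eq_dirac_of_ae_eq (hx2.mono fun y hy => ?_)
      by_contra hne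
      exact hx1 ⟨y, y₀, hne, hy, hy₀⟩
    have hTx : T x = y₀ := by
      simp only [T, hκ, integral_dirac]
    rw [ProbabilityTheory.Kernel.deterministic_apply, hTx, hκ]
  calc q = q.fst ⊗ₘ κ := hdis.symm
    _ = q.fst ⊗ₘ ProbabilityTheory.Kernel.deterministic T hT := Measure.compProd_congr hdirac
    _ = (q.map Prod.fst).map fun x => (x, T x) := Measure.compProd_deterministic hT

theorem eq_map_of_ae_snd_eq {X Y : Type*} [MeasurableSpace X] [MeasurableSpace Y]
    {m : Measure (X × Y)} {T : X → Y} (hT : Measurable T) (h : ∀ᵐ p ∂m, p.2 = T p.1) :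
    m = (m.map Prod.fst).map fun x => (x, T x) := by
  rw [Measure.map_map (by fun_prop) measurable_fst]
  calc m = m.map id := Measure.map_id.symm
    _ = m.map ((fun x => (x, T x)) ∘ Prod.fst) :=
        Measure.map_congr (h.mono fun p hp => Prod.ext rfl hp)

/-- The average of `q₁` and `q₂` is an optimizer, hence carried by a single graph, which then
carries both. A measure on a graph is determined by its first marginal, and these agree. -/
theorem IsOptimizer.eq [IsFiniteMeasure μ] [IsFiniteMeasure ν] (hsing : μ ⟂ₘ ν)
    (hsmall : DoesNotChargeSmallSets μ) (hnonneg : ∀ t ∈ Ici (0 : ℝ), 0 ≤ ϑ t)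
    (hmono : StrictMonoOn ϑ (Ici 0)) (hconc : StrictConcaveOn ℝ (Ici 0) ϑ)
    (hfin : optimalCost ϑ μ ν < ∞) {q₁ q₂ : Measure _}
    (h₁ : IsOptimizer ϑ μ ν q₁) (h₂ : IsOptimizer ϑ μ ν q₂) : q₁ = q₂ := by
  obtain ⟨T, hT, hq⟩ := (h₁.average h₂).exists_eq_map hsing hsmall hnonneg hmono hconc hfin
  have hgraph : ∀ᵐ p ∂((2⁻¹ : ℝ≥0∞) • q₁ + (2⁻¹ : ℝ≥0∞) • q₂), p.2 = T p.1 := by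
    rw [hq, ae_map_iff (by fun_prop) (measurableSet_eq_fun measurable_snd (by fun_prop))]
    exact Eventually.of_forall fun _ => rfl
  rw [ae_add_measure_iff, Measure.ae_ennreal_smul_measure_iff (by simp),
    Measure.ae_ennreal_smul_measure_iff (by simp)] at hgraph
  rw [eq_map_of_ae_snd_eq hT hgraph.1, eq_map_of_ae_snd_eq hT hgraph.2,
    h₁.map_fst_eq hsing hsmall hnonneg hmono hfin h₂]

end Structure

theorem lemma2p2 (d : ℕ) (μ ν : Measure (EuclideanSpace ℝ (Fin d)))
    [IsFiniteMeasure μ] [IsFiniteMeasure ν]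
    (hmass : ν univ ≤ μ univ) (hsing : μ ⟂ₘ ν) (hsmall : DoesNotChargeSmallSets μ)
    (ϑ : ℝ → ℝ) (hnonneg : ∀ t ∈ Ici (0 : ℝ), 0 ≤ ϑ t)
    (hmono : StrictMonoOn ϑ (Ici 0)) (hconc : ConcaveOn ℝ (Ici 0) ϑ)
    (hfin : optimalCost ϑ μ ν < ∞) :
    ∃ B : Set (EuclideanSpace ℝ (Fin d)), MeasurableSet B ∧
      (∃ q, IsOptimizer ϑ μ ν q) ∧
      (∀ q, IsOptimizer ϑ μ ν q → q.map Prod.fst = μ.restrict B) ∧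
      (StrictConcaveOn ℝ (Ici 0) ϑ →
        (∃! q, IsOptimizer ϑ μ ν q) ∧
        ∃ T : EuclideanSpace ℝ (Fin d) → EuclideanSpace ℝ (Fin d), Measurable T ∧
          ∀ q, IsOptimizer ϑ μ ν q → q = (μ.restrict B).map (fun x => (x, T x))) := by
  obtain ⟨q₀, h₀⟩ := exists_isOptimizer hnonneg hmono.monotoneOn hconc hfin
  obtain ⟨B, hB, hfst⟩ := h₀.map_fst_eq_restrict hsing hsmall hnonneg hmono hfin
  refine ⟨B, hB, ⟨q₀, h₀⟩, fun q hq => ?_, fun hstrict => ?_⟩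
  · rw [hq.map_fst_eq hsing hsmall hnonneg hmono hfin h₀, hfst]
  · obtain ⟨T, hT, hmap⟩ := h₀.exists_eq_map hsing hsmall hnonneg hmono hstrict hfin
    have huniq : ∀ q, IsOptimizer ϑ μ ν q → q = q₀ := fun q hq =>
      hq.eq hsing hsmall hnonneg hmono hstrict hfin h₀
    refine ⟨⟨q₀, h₀, huniq⟩, T, hT, fun q hq => ?_⟩
    rw [huniq q hq, ← hfst]
    exact hmap
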